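/- **Proposition 2.9.** In each of the two contexts (V) and (R) below, consider a family of profiles indexed by the shock strength $\varepsilon\in(0,\varepsilon_0)$, $\varepsilon=|u^\varepsilon_+-u^\varepsilon_-|$. Then there are $\varepsilon_1\in(0,\varepsilon_0]$ and a function $r$ with $r(\varepsilon)\to0$ as $\varepsilon\to0^+$ such that, for every $\varepsilon\in(0,\varepsilon_1)$, every eigenvalue $\lambda\in\mathbb C$ with $\operatorname{Re}\lambda\ge0$ of the operator $L^\varepsilon$ obtained by linearizing about the profile satisfies $|\lambda|\le r(\varepsilon)$. Here $\lambda$ is an eigenvalue if $L^\varepsilon w=\lambda w$ has a solution $w\in L^2(\mathbb R)$, $w\not\equiv0$ (complex vector valued). In both contexts, "$a=0$ is a genuinely nonlinear simple eigenvalue of $Df(u_0)$" means: $0$ is a simple eigenvalue of $Df(u_0)$ with left and right eigenvectors $l,r$, and $l\cdot D^2f(u_0)(r,r)\neq0$. A matrix has "real simple spectrum" if all its eigenvalues are real and simple. (V) *Viscous systems* $u_t+f(u)_x=(B(u)u_x)_x$, $u\in\mathbb R^n$, where $f,B$ are $C^2$ on an open neighborhood $U$ of $u_0\in\mathbb R^n$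 and, at $u_0$: $\operatorname{Re}\sigma(B(u_0))>0$; $Df(u_0)$ has real simple spectrum; for some $\theta>0$, $\operatorname{Re}\sigma(-i\xi Df(u_0)-\xi^2B(u_0))\le-\theta\xi^2$ for all $\xi\in\mathbb R$; and $0$ is a genuinely nonlinear simple eigenvalue of $Df(u_0)$. The profiles are stationary solutions $\bar u^\varepsilon:\mathbb R\to U$, $f(\bar u^\varepsilon)'=(B(\bar u^\varepsilon)(\bar u^{\varepsilon})')'$, with $\bar u^\varepsilon(x)\to u^\varepsilon_\pm$ as $x\to\pm\infty$, converging to $u_0$ uniformly in $x\in\mathbb R$ as $\varepsilon\to0$. The linearized operator is $$L^\varepsilon w=(B(\bar u^\varepsilon)w'-A^\varepsilon w)',\qquad A^\varepsilon w=Df(\bar u^\varepsilon)w-(DB(\bar u^\varepsilon)w)(\bar u^\varepsilon)'.$$ (R) *Relaxation systems* $u_t+\tilde f(u,v)_x=0$, $v_t+\tilde g(u,v)_x=q(u,v)$, $u\in\mathbb R^n$, $v\in\mathbb R^m$. There are an open neighborhood $V$ of $u_0$ and a $C^2$ function $v^*$ on $V$ with graph in an open set $U\subset\mathbb R^n\times\mathbb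 R^m$ such that $q(u,v^*(u))=0$ and $\operatorname{Re}\sigma(q_v(u,v^*(u)))<0$ for $u\in V$; put $f(u)=\tilde f(u,v^*(u))$ and $v_0=v^*(u_0)$. Assume: $\tilde f,\tilde g,q$ are $C^2$ on $U$; the spectrum of $D(\tilde f,\tilde g)(u,v)$ is, for $(u,v)\in U$, real, semisimple, of constant multiplicities, and uniformly bounded away from $0$; for some $\theta>0$, $\operatorname{Re}\sigma\big(i\xi D(\tilde f,\tilde g)(u_0,v_0)+(0,Dq(u_0,v_0))\big)\le-\theta\xi^2/(1+\xi^2)$ for all $\xi\in\mathbb R$; and $0$ is a genuinely nonlinear simple eigenvalue of $Df(u_0)$. The profiles are stationary solutions $(\bar u^\varepsilon,\bar v^\varepsilon):\mathbb R\to U$, $\tilde f(\bar u^\varepsilon,\bar v^\varepsilon)'=0$, $\tilde g(\bar u^\varepsilon,\bar v^\varepsilon)'=q(\bar u^\varepsilon,\bar v^\varepsilon)$, with limits $(u^\varepsilon_\pm,v^\varepsilon_\pm)$ as $x\to\pm\infty$, where $u_\pm^\varepsilon\in V$ and $Df(u^\varepsilon_\pm)$ has real simple spectrum, converging to $(u_0,v_0)$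 uniformly in $x\in\mathbb R$ as $\varepsilon\to0$. The linearized operator is $$L^\varepsilon W=-(\mathcal A^\varepsilon W)'+\mathcal Q^\varepsilon W,\qquad \mathcal A^\varepsilon=D(\tilde f,\tilde g)(\bar u^\varepsilon,\bar v^\varepsilon),\quad \mathcal Q^\varepsilon=(0,Dq(\bar u^\varepsilon,\bar v^\varepsilon)).$$ -/

import Mathlib

open Filter Topology MeasureTheory Set
open scoped Matrix

noncomputable section

/-- The state space `ℝⁿ` with its Euclidean norm. -/
abbrev RVec (n : ℕ) : Type := EuclideanSpace ℝ (Fin n)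

/-- The standard basis of `ℝⁿ`. -/
def stdBasis (n : ℕ) : Module.Basis (Fin n) ℝ (RVec n) :=
  (EuclideanSpace.basisFun (Fin n) ℝ).toBasis

/-- The standard basis of `ℝⁿ × ℝᵐ`. -/
def stdBasisProd (n m : ℕ) : Module.Basis (Fin n ⊕ Fin m) ℝ (RVec n × RVec m) :=
  (stdBasis n).prod (stdBasis m)

/-- The matrix of a real linear operator in a basis, regarded as a complex matrix
(so that it acts on complex vectors and has its full complex spectrum). -/
def cMatrix {ι V : Type*} [Fintype ι] [DecidableEq ι] [NormedAddCommGroup V] [NormedSpace ℝ V]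
    (b : Module.Basis ι ℝ V) (T : V →L[ℝ] V) : Matrix ι ι ℂ :=
  (LinearMap.toMatrix b b (T : V →ₗ[ℝ] V)).map (fun x : ℝ => (x : ℂ))

/-- The spectrum of `T : ℝⁿ → ℝⁿ` is real and simple: there are `n` distinct real eigenvalues. -/
def RealSimpleSpectrum {n : ℕ} (T : RVec n →L[ℝ] RVec n) : Prop :=
  ∃ a : Fin n → ℝ, StrictMono a ∧
    ∀ j, Module.End.HasEigenvalue (T : RVec n →ₗ[ℝ] RVec n) (a j)

/-- Zero is an (algebraically) simple eigenvalue of `Df(u₀)`, with left and right eigenvectors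
`l`, `r`, and the corresponding characteristic field is genuinely nonlinear at `u₀`:
`l · D²f(u₀)(r, r) ≠ 0`. -/
def GenuinelyNonlinearZeroField {n : ℕ} (f : RVec n → RVec n) (u₀ : RVec n) : Prop :=
  ((fderiv ℝ f u₀ : RVec n →L[ℝ] RVec n) : RVec n →ₗ[ℝ] RVec n).charpoly.rootMultiplicity 0 = 1 ∧
  ∃ l r : RVec n, l ≠ 0 ∧ r ≠ 0 ∧
    (∀ v, inner ℝ l (fderiv ℝ f u₀ v) = 0) ∧ fderiv ℝ f u₀ r = 0 ∧
    inner ℝ l (fderiv ℝ (fderiv ℝ f) u₀ r r) ≠ 0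

/-! ### Viscous conservation laws `u_t + f(u)_x = (B(u) u_x)_x` -/

/-- The standing hypotheses on a strictly parabolic system of viscous conservation laws near
the state `u₀`. -/
structure ViscousHypotheses {n : ℕ} (f : RVec n → RVec n) (B : RVec n → RVec n →L[ℝ] RVec n)
    (U : Set (RVec n)) (u₀ : RVec n) : Prop where
  isOpen : IsOpen U
  mem : u₀ ∈ U
  /-- regularity -/
  contDiff_f : ContDiffOn ℝ 2 f U
  contDiff_B : ContDiffOn ℝ 2 B U
  /-- strict parabolicity -/
  parabolic : ∀ μ ∈ spectrum ℂ (cMatrix (stdBasis n) (B u₀)), 0 < μ.re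
  /-- strict hyperbolicity -/
  hyperbolic : RealSimpleSpectrum (fderiv ℝ f u₀)
  /-- linearized stability of the constant state -/
  stable : ∃ θ : ℝ, 0 < θ ∧ ∀ ξ : ℝ,
    ∀ μ ∈ spectrum ℂ (-(Complex.I * (ξ : ℂ)) • cMatrix (stdBasis n) (fderiv ℝ f u₀)
        - ((ξ : ℂ) ^ 2) • cMatrix (stdBasis n) (B u₀)),
      μ.re ≤ -θ * ξ ^ 2
  /-- genuine nonlinearity of the principal field, whose speed vanishes at `u₀` -/
  nonlinear : GenuinelyNonlinearZeroField f u₀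

/-- `ubar` is a stationary solution in `U`, with limits `um`, `up` at `-∞`, `+∞`: the equation
`f(ubar)' = (B(ubar) ubar')'` is written as `(B(ubar) ubar' - f(ubar))' = 0`. -/
structure IsViscousProfile {n : ℕ} (f : RVec n → RVec n) (B : RVec n → RVec n →L[ℝ] RVec n)
    (U : Set (RVec n)) (ubar : ℝ → RVec n) (um up : RVec n) : Prop where
  mem : ∀ x, ubar x ∈ U
  differentiable : Differentiable ℝ ubar
  equation : ∀ x, HasDerivAt (fun y => B (ubar y) (deriv ubar y) - f (ubar y)) 0 x
  tendsto_atBot : Tendsto ubar atBot (𝓝 um)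
  tendsto_atTop : Tendsto ubar atTop (𝓝 up)

/-- The coefficient `A(x) v = Df(ubar(x)) v - (DB(ubar(x)) v) ubar'(x)`. -/
def viscousA {n : ℕ} (f : RVec n → RVec n) (B : RVec n → RVec n →L[ℝ] RVec n)
    (ubar : ℝ → RVec n) (x : ℝ) : RVec n →L[ℝ] RVec n :=
  fderiv ℝ f (ubar x) - (fderiv ℝ B (ubar x)).flip (deriv ubar x)

/-- `lam` is an eigenvalue of the operator `L w = (B(ubar) w' - A w)'` obtained by linearizing
about `ubar`: the equation `L w = lam w` has a nonzero solution in `L²(ℝ; ℂⁿ)`. -/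
def IsViscousEigenvalue {n : ℕ} (f : RVec n → RVec n) (B : RVec n → RVec n →L[ℝ] RVec n)
    (ubar : ℝ → RVec n) (lam : ℂ) : Prop :=
  ∃ w : ℝ → (Fin n → ℂ), w ≠ 0 ∧ MemLp w 2 volume ∧ Differentiable ℝ w ∧
    ∀ x, HasDerivAt
      (fun y => cMatrix (stdBasis n) (B (ubar y)) *ᵥ deriv w y
        - cMatrix (stdBasis n) (viscousA f B ubar y) *ᵥ w y)
      (lam • w x) x

/-! ### Relaxation systems `u_t + F(u,v)_x = 0`, `v_t + G(u,v)_x = q(u,v)` -/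

/-- The flux Jacobian `(DF, DG)` of a relaxation system at a point `(u, v)`. -/
def relaxA {n m : ℕ} (F : RVec n × RVec m → RVec n) (G : RVec n × RVec m → RVec m)
    (p : RVec n × RVec m) : RVec n × RVec m →L[ℝ] RVec n × RVec m :=
  (fderiv ℝ F p).prod (fderiv ℝ G p)

/-- The Jacobian `(0, Dq)` of the source term of a relaxation system at a point `(u, v)`. -/
def relaxQ {n m : ℕ} (q : RVec n × RVec m → RVec m)
    (p : RVec n × RVec m) : RVec n × RVec m →L[ℝ] RVec n × RVec m :=
  (0 : RVec n × RVec m →L[ℝ] RVec n).prod (fderiv ℝ q p)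

/-- The flux `f(u) = F(u, v*(u))` of the equilibrium system. -/
def equilibriumFlux {n m : ℕ} (F : RVec n × RVec m → RVec n) (vstar : RVec n → RVec m)
    (u : RVec n) : RVec n :=
  F (u, vstar u)

/-- On the set `U`, the spectrum of the operators `A p` is real, semisimple, of constant
multiplicities (`k` distinct eigenvalues, the `j`-th in increasing order with eigenspace of
dimension `d j`, and these dimensions add up to that of the whole space), and uniformly bounded
away from `0`. -/
def RealSemisimpleConstMult {V : Type*} [NormedAddCommGroup V] [NormedSpace ℝ V]
    (A : V → V →L[ℝ] V) (U : Set V) : Prop :=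
  ∃ (k : ℕ) (d : Fin k → ℕ) (c : ℝ), 0 < c ∧ (∀ j, 0 < d j) ∧ ∑ j, d j = Module.finrank ℝ V ∧
    ∀ p ∈ U, ∃ a : Fin k → ℝ, StrictMono a ∧ ∀ j, c ≤ |a j| ∧
      Module.finrank ℝ (Module.End.eigenspace (A p : V →ₗ[ℝ] V) (a j)) = d j

/-- The standing hypotheses on a relaxation system near the equilibrium state `(u₀, v*(u₀))`,
apart from strict hyperbolicity of the equilibrium system, which is imposed at the endstates
of the profiles. -/
structure RelaxationHypotheses {n m : ℕ} (F : RVec n × RVec m → RVec n)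
    (G q : RVec n × RVec m → RVec m) (vstar : RVec n → RVec m)
    (U : Set (RVec n × RVec m)) (V : Set (RVec n)) (u₀ : RVec n) : Prop where
  isOpen_U : IsOpen U
  isOpen_V : IsOpen V
  mem : u₀ ∈ V
  /-- the equilibrium manifold: a smooth graph, on which `q` vanishes and `q_v` is stable -/
  contDiff_vstar : ContDiffOn ℝ 2 vstar V
  graph_mem : ∀ u ∈ V, (u, vstar u) ∈ U
  equilibrium : ∀ u ∈ V, q (u, vstar u) = 0
  stable_source : ∀ u ∈ V,
    ∀ μ ∈ spectrum ℂ (cMatrix (stdBasis m) (fderiv ℝ (fun v => q (u, v)) (vstar u))), μ.re < 0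
  /-- regularity -/
  contDiff_F : ContDiffOn ℝ 2 F U
  contDiff_G : ContDiffOn ℝ 2 G U
  contDiff_q : ContDiffOn ℝ 2 q U
  /-- nonstrict hyperbolicity of the relaxation system, with nonzero characteristic speeds -/
  hyperbolic : RealSemisimpleConstMult (relaxA F G) U
  /-- linearized stability of the constant state -/
  stable : ∃ θ : ℝ, 0 < θ ∧ ∀ ξ : ℝ,
    ∀ μ ∈ spectrum ℂ
        ((Complex.I * (ξ : ℂ)) • cMatrix (stdBasisProd n m) (relaxA F G (u₀, vstar u₀))
          + cMatrix (stdBasisProd n m) (relaxQ q (u₀, vstar u₀))),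
      μ.re ≤ -θ * ξ ^ 2 / (1 + ξ ^ 2)
  /-- genuine nonlinearity of the principal equilibrium field, whose speed vanishes at `u₀` -/
  nonlinear : GenuinelyNonlinearZeroField (equilibriumFlux F vstar) u₀

/-- `(ubar, vbar)` is a stationary solution in `U`, i.e. `F(ubar, vbar)' = 0` and
`G(ubar, vbar)' = q(ubar, vbar)`, with limits `(um, vm)`, `(up, vp)` at `-∞`, `+∞`. -/
structure IsRelaxationProfile {n m : ℕ} (F : RVec n × RVec m → RVec n)
    (G q : RVec n × RVec m → RVec m) (U : Set (RVec n × RVec m))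
    (ubar : ℝ → RVec n) (vbar : ℝ → RVec m) (um up : RVec n) (vm vp : RVec m) : Prop where
  mem : ∀ x, (ubar x, vbar x) ∈ U
  differentiable_u : Differentiable ℝ ubar
  differentiable_v : Differentiable ℝ vbar
  equation_u : ∀ x, HasDerivAt (fun y => F (ubar y, vbar y)) 0 x
  equation_v : ∀ x, HasDerivAt (fun y => G (ubar y, vbar y)) (q (ubar x, vbar x)) x
  tendsto_u_atBot : Tendsto ubar atBot (𝓝 um)
  tendsto_u_atTop : Tendsto ubar atTop (𝓝 up)
  tendsto_v_atBot : Tendsto vbar atBot (𝓝 vm)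
  tendsto_v_atTop : Tendsto vbar atTop (𝓝 vp)

/-- `lam` is an eigenvalue of the operator `L W = -(A W)' + Q W` obtained by linearizing about
`(ubar, vbar)`: the equation `(A W)' = (Q - lam) W` has a nonzero solution in
`L²(ℝ; ℂⁿ × ℂᵐ)`. -/
def IsRelaxationEigenvalue {n m : ℕ} (F : RVec n × RVec m → RVec n)
    (G q : RVec n × RVec m → RVec m) (ubar : ℝ → RVec n) (vbar : ℝ → RVec m) (lam : ℂ) : Prop :=
  ∃ W : ℝ → (Fin n ⊕ Fin m → ℂ), W ≠ 0 ∧ MemLp W 2 volume ∧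
    ∀ x, HasDerivAt
      (fun y => cMatrix (stdBasisProd n m) (relaxA F G (ubar y, vbar y)) *ᵥ W y)
      (cMatrix (stdBasisProd n m) (relaxQ q (ubar x, vbar x)) *ᵥ W x - lam • W x) x

end

/-!
A weak profile is a small, slowly varying perturbation of the constant state `u₀`: being uniformly
close to `u₀`, it also has a uniformly small derivative (`norm_deriv_le_of_nearly_const`,
`RelaxationHypotheses.eventually_state_mem`). So it suffices to fix `δ > 0` and to show that, for
coefficients close to those at `u₀`, there is no eigenvalue with `Re λ ≥ 0` and `|λ| > δ`; the
modulus `r(ε)` is then the supremum of `|λ|` over the unstable eigenvalues (`exists_modulus`).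

The eigenvalue equation is a first-order system `(N v)' = M v` whose matrices depend on `λ` and on
the state. By the dissipativity hypothesis, at `u₀` the pencil `(N, M)` has no purely imaginary
modes when `Re λ ≥ 0`, `λ ≠ 0`. Lyapunov's theorem gives a Hermitian matrix `S` for which
`(N v)ᴴ S (N v)` has derivative at least `c ‖v‖²` along solutions (`exists_pencil_symmetrizer`).
This survives a small perturbation of the coefficients, uniformly for parameters in a compact set
(`exists_uniform_pencil_symmetrizer`). An energy that expands in this way, and which does not grow
exponentially because the solution is in `L²`, vanishes identically, and so does the solution
(`eq_zero_of_energy`, `eq_zero_of_pencil`).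

For viscous systems the scaling `ζ = λ/|λ|`, `τ = |λ|^(-1/2)` compactifies the whole region
`|λ| ≥ δ`: the limit `τ = 0` is governed by `B(u₀)` alone, whose spectrum lies in the right
half-plane.

For relaxation systems that argument covers the compact range `δ ≤ |λ| ≤ R`. Large `λ` require an
energy adapted to the variable coefficients, as `λ` multiplies every error made in symmetrizing the
flux matrix `A`. Constancy of the multiplicities provides a `C¹` family `S` of exact symmetrizers,
because the symmetrizers are the kernel of a linear map of constant rank
(`exists_contDiffAt_ker_section`, `exists_contDiffAt_symmetrizer`); its derivative along the profile
is small with the derivative of the profile. Stability at high frequency says that the block part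
of `Q` along the eigenspaces of `A` is stable (`re_neg_of_blockPart_mulVec`), so that `S` can be
chosen with `AᴴS` negative definite and with a compensating matrix `K` that restores the
dissipation missing from `Q` (`exists_compensator`). The energy with matrix
`S + (Im λ/|λ|²) K` expands for all large `λ` (`exists_highFrequency_energy`).
-/

/-! ### Lyapunov matrices -/

open scoped InnerProductSpace in
/-- **Lyapunov's theorem**: an operator `G` without spectrum on the imaginary axis admits a
self-adjoint `S` such that `S G` has positive definite real part; if moreover the spectrum of `G`
lies in the open left half-plane, `S` is negative definite. The proof is by induction on the
dimension, splitting off a left eigenvector, so that no spectral projections are needed. -/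
theorem exists_lyapunov_operator (n : ℕ) :
    ∀ (V : Type) [NormedAddCommGroup V] [InnerProductSpace ℂ V] [FiniteDimensional ℂ V],
      Module.finrank ℂ V = n → ∀ G : V →L[ℂ] V,
      (∀ (μ : ℂ) (x : V), x ≠ 0 → G x = μ • x → μ.re ≠ 0) →
      ∃ S : V →L[ℂ] V, (∀ x y, ⟪S x, y⟫_ℂ = ⟪x, S y⟫_ℂ) ∧
        (∃ c > 0, ∀ x, c * ‖x‖ ^ 2 ≤ (⟪x, S (G x)⟫_ℂ).re) ∧
        ((∀ (μ : ℂ) (x : V), x ≠ 0 → G x = μ • x → μ.re < 0) →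
          ∃ c > 0, ∀ x, c * ‖x‖ ^ 2 ≤ -(⟪x, S x⟫_ℂ).re) := by
  induction n with
  | zero =>
    intro V _ _ _ hV G hG
    have : Subsingleton V := Module.finrank_zero_iff.mp hV
    refine ⟨0, by simp, ⟨1, one_pos, fun x => ?_⟩, fun _ => ⟨1, one_pos, fun x => ?_⟩⟩ <;>
      simp [Subsingleton.elim x 0]
  | succ n ih =>
    intro V _ _ _ hV G hG
    have : Nontrivial V := Module.nontrivial_of_finrank_pos (R := ℂ) (by omega)
    -- a left eigenvector `v` of `G`, whose orthogonal complement is invariant under `G`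
    obtain ⟨ν, hν⟩ := Module.End.exists_eigenvalue
      ((ContinuousLinearMap.adjoint G : V →L[ℂ] V) : V →ₗ[ℂ] V)
    obtain ⟨v', hv'⟩ := hν.exists_hasEigenvector
    have hv'0 : v' ≠ 0 := hv'.2
    have hv'e : ContinuousLinearMap.adjoint G v' = ν • v' := hv'.apply_eq_smul
    set v : V := ((‖v'‖⁻¹ : ℝ) : ℂ) • v' with hv
    have hvn : ‖v‖ = 1 := by
      rw [hv, norm_smul]; simp [norm_ne_zero_iff.mpr hv'0]
    have hve : ContinuousLinearMap.adjoint G v = ν • v := by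
      rw [hv, map_smul, hv'e, smul_comm]
    have hvv : ⟪v, v⟫_ℂ = 1 := by rw [inner_self_eq_norm_sq_to_K, hvn]; simp
    set μ : ℂ := starRingEnd ℂ ν
    have hvG : ∀ x, ⟪v, G x⟫_ℂ = μ * ⟪v, x⟫_ℂ := fun x => by
      rw [← ContinuousLinearMap.adjoint_inner_left, hve, inner_smul_left]
    -- `μ` is an eigenvalue of `G`
    have hμG : ∃ x, x ≠ 0 ∧ G x = μ • x := by
      by_contra! hcon
      have hinj : Function.Injective (G - μ • ContinuousLinearMap.id ℂ V : V →L[ℂ] V) := by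
        rw [injective_iff_map_eq_zero]
        intro x hx
        by_contra hx0
        exact hcon x hx0 (by simpa [sub_eq_zero] using hx)
      have hsurj := LinearMap.surjective_of_injective (f :=
        ((G - μ • ContinuousLinearMap.id ℂ V : V →L[ℂ] V) : V →ₗ[ℂ] V)) hinj
      obtain ⟨x, hx⟩ := hsurj v
      have h1 : ⟪v, (G - μ • ContinuousLinearMap.id ℂ V : V →L[ℂ] V) x⟫_ℂ = 0 := by
        simp [hvG]
      have h2 : (G - μ • ContinuousLinearMap.id ℂ V : V →L[ℂ] V) x = v := hx
      rw [h2, hvv] at h1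
      exact one_ne_zero h1
    set W : Submodule ℂ V := (ℂ ∙ v)ᗮ
    have hmem : ∀ x, x ∈ W ↔ ⟪v, x⟫_ℂ = 0 := fun x =>
      Submodule.mem_orthogonal_singleton_iff_inner_right
    have hdim : Module.finrank ℂ W = n := by
      have h1 := Submodule.finrank_add_finrank_orthogonal (ℂ ∙ v)
      rw [finrank_span_singleton (by rintro h; simp [h] at hvn), hV] at h1
      exact (by omega : Module.finrank ℂ (ℂ ∙ v)ᗮ = n)
    let GW : W →L[ℂ] W := (G.comp W.subtypeL).codRestrict W (fun x => by
      rw [hmem]; simp [hvG, (hmem x).1 x.2])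
    have hGW : ∀ x : W, ((GW x : W) : V) = G x := fun x => rfl
    have heig : ∀ (κ : ℂ) (x : W), x ≠ 0 → GW x = κ • x → (x : V) ≠ 0 ∧ G x = κ • (x : V) := by
      intro κ x hx h
      refine ⟨by simpa using hx, ?_⟩
      rw [← hGW, h]; rfl
    obtain ⟨S, hS, ⟨c, hc, hcS⟩, hSneg⟩ := ih W hdim GW
      (fun κ x hx h => hG κ x (heig κ x hx h).1 (heig κ x hx h).2)
    let P : V →L[ℂ] W := (ContinuousLinearMap.id ℂ V -
      ((innerSL ℂ v).smulRight v)).codRestrict W (fun x => by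
        rw [hmem]; simp [hvn])
    have hP : ∀ x, ((P x : W) : V) = x - ⟪v, x⟫_ℂ • v := fun x => rfl
    have hWv : ∀ p : W, ⟪(p : V), v⟫_ℂ = 0 := fun p => by
      rw [← inner_conj_symm, (hmem p).1 p.2]; simp
    have hPin : ∀ (x : V) (p : W), ⟪x, (p : V)⟫_ℂ = ⟪P x, p⟫_ℂ := fun x p => by
      rw [Submodule.coe_inner, hP, inner_sub_left, inner_smul_left, (hmem p).1 p.2]; simp
    have hdec : ∀ x, x = (P x : V) + ⟪v, x⟫_ℂ • v := fun x => by rw [hP]; simp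
    have hnorm : ∀ x, ‖x‖ ^ 2 = ‖P x‖ ^ 2 + ‖⟪v, x⟫_ℂ‖ ^ 2 := fun x => by
      conv_lhs => rw [hdec x]
      rw [@norm_add_sq ℂ, inner_smul_right, hWv, norm_smul, hvn]
      simp
    set b : W := P (G v)
    have hPG : ∀ x, P (G x) = GW (P x) + ⟪v, x⟫_ℂ • b := fun x => by
      conv_lhs => rw [hdec x, map_add, map_add, map_smul, map_smul]
      congr 1
      apply Subtype.ext
      rw [hP, hGW, hvG, (hmem _).1 (P x).2]; simp
    set m : ℝ := |μ.re|
    have hm0 : 0 < m := by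
      obtain ⟨x, hx, hx'⟩ := hμG
      exact abs_pos.mpr (hG μ x hx hx')
    set C : ℝ := ‖S‖ * ‖b‖
    have hCb : ∀ p : W, ‖⟪p, S b⟫_ℂ‖ ≤ C * ‖p‖ := fun p => by
      calc _ ≤ ‖p‖ * ‖S b‖ := norm_inner_le_norm _ _
        _ ≤ ‖p‖ * (‖S‖ * ‖b‖) := by gcongr; exact S.le_opNorm b
        _ = C * ‖p‖ := by ring
    -- the new direction gets a weight large enough to absorb the coupling `b`
    set K : ℝ := (C ^ 2 / (2 * c) + 1) / m with hK
    have hK0 : 0 < K := by positivity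
    set σ : ℝ := ((SignType.sign μ.re : SignType) : ℝ) with hσ
    have hσm : σ * μ.re = m := sign_mul_self μ.re
    let T : V →L[ℂ] V := (W.subtypeL.comp S).comp P +
      ((K * σ : ℝ) : ℂ) • (innerSL ℂ v).smulRight v
    have hT : ∀ x, T x = (S (P x) : V) + ((K * σ : ℝ) : ℂ) • ⟪v, x⟫_ℂ • v := fun x => rfl
    have hTin : ∀ x y, ⟪x, T y⟫_ℂ = ⟪P x, S (P y)⟫_ℂ +
        ((K * σ : ℝ) : ℂ) * (starRingEnd ℂ ⟪v, x⟫_ℂ * ⟪v, y⟫_ℂ) := fun x y => by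
      rw [hT, inner_add_right, hPin, inner_smul_right, inner_smul_right, inner_conj_symm]
      ring
    refine ⟨T, fun x y => ?_, ?_, fun hneg => ?_⟩
    · rw [← inner_conj_symm, hTin, hTin, ← hS, ← inner_conj_symm (P x)]
      simp only [map_add, map_mul, Complex.conj_ofReal, Complex.conj_conj]
      ring
    · refine ⟨min (c / 2) 1, by positivity, fun x => ?_⟩
      have h1 : (⟪x, T (G x)⟫_ℂ).re = (⟪P x, S (GW (P x))⟫_ℂ).re +
          (⟪v, x⟫_ℂ * ⟪P x, S b⟫_ℂ).re + K * m * ‖⟪v, x⟫_ℂ‖ ^ 2 := by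
        rw [hTin, hPG, map_add, map_smul, inner_add_right, inner_smul_right, hvG]
        rw [show ((K * σ : ℝ) : ℂ) * (starRingEnd ℂ ⟪v, x⟫_ℂ * (μ * ⟪v, x⟫_ℂ))
          = ((K * σ * ‖⟪v, x⟫_ℂ‖ ^ 2 : ℝ) : ℂ) * μ by
            have := Complex.conj_mul' ⟪v, x⟫_ℂ
            push_cast
            rw [← this]; ring]
        rw [Complex.add_re, Complex.add_re, Complex.re_ofReal_mul, ← hσm]
        ring
      have h2 : -(‖⟪v, x⟫_ℂ‖ * (C * ‖P x‖)) ≤ (⟪v, x⟫_ℂ * ⟪P x, S b⟫_ℂ).re := by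
        have := Complex.abs_re_le_norm (⟪v, x⟫_ℂ * ⟪P x, S b⟫_ℂ)
        rw [norm_mul] at this
        have h3 := mul_le_mul_of_nonneg_left (hCb (P x)) (norm_nonneg ⟪v, x⟫_ℂ)
        linarith [neg_abs_le (⟪v, x⟫_ℂ * ⟪P x, S b⟫_ℂ).re]
      have hKm : K * m = C ^ 2 / (2 * c) + 1 := by rw [hK]; field_simp
      rw [h1, hKm, hnorm]
      have h4 := hcS (P x)
      set p := ‖P x‖
      set t := ‖⟪v, x⟫_ℂ‖
      have h5 : 0 ≤ c / 2 * p ^ 2 - t * (C * p) + C ^ 2 / (2 * c) * t ^ 2 := by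
        have : c / 2 * p ^ 2 - t * (C * p) + C ^ 2 / (2 * c) * t ^ 2
            = c / 2 * (p - C / c * t) ^ 2 := by field_simp; ring
        rw [this]; positivity
      have h6 : min (c / 2) 1 * p ^ 2 ≤ c / 2 * p ^ 2 := by gcongr; exact min_le_left _ _
      have h7 : min (c / 2) 1 * t ^ 2 ≤ 1 * t ^ 2 := by gcongr; exact min_le_right _ _
      nlinarith
    · obtain ⟨c', hc', h'⟩ := hSneg fun κ x hx h => hneg κ x (heig κ x hx h).1 (heig κ x hx h).2
      obtain ⟨x₀, hx₀, hx₀'⟩ := hμG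
      have hσ1 : σ = -1 := by
        rw [hσ, sign_neg (hneg μ x₀ hx₀ hx₀')]; simp
      refine ⟨min c' K, lt_min hc' hK0, fun x => ?_⟩
      have h1 : (⟪x, T x⟫_ℂ).re = (⟪P x, S (P x)⟫_ℂ).re - K * ‖⟪v, x⟫_ℂ‖ ^ 2 := by
        rw [hTin, Complex.conj_mul', hσ1, Complex.add_re, Complex.re_ofReal_mul,
          ← Complex.ofReal_pow, Complex.ofReal_re]
        ring
      rw [h1, hnorm]
      have h6 : min c' K * ‖P x‖ ^ 2 ≤ c' * ‖P x‖ ^ 2 := by gcongr; exact min_le_left _ _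
      have h7 : min c' K * ‖⟪v, x⟫_ℂ‖ ^ 2 ≤ K * ‖⟪v, x⟫_ℂ‖ ^ 2 := by
        gcongr; exact min_le_right _ _
      linarith [h' (P x)]

/-- A complex matrix is accretive if its Hermitian part is positive definite. The matrix itself need
not be Hermitian, in contrast with `Matrix.PosDef`. -/
def Accretive {ι : Type*} [Fintype ι] (M : Matrix ι ι ℂ) : Prop :=
  ∀ v : ι → ℂ, v ≠ 0 → 0 < (star v ⬝ᵥ M *ᵥ v).re

theorem exists_lyapunov_matrix {ι : Type} [Fintype ι] [DecidableEq ι] (G : Matrix ι ι ℂ)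
    (hG : ∀ (μ : ℂ) (x : ι → ℂ), x ≠ 0 → G *ᵥ x = μ • x → μ.re ≠ 0) :
    ∃ S : Matrix ι ι ℂ, S.IsHermitian ∧ Accretive (S * G) ∧
      ((∀ (μ : ℂ) (x : ι → ℂ), x ≠ 0 → G *ᵥ x = μ • x → μ.re < 0) → Accretive (-S)) := by
  have heig : ∀ (μ : ℂ) (x : EuclideanSpace ℂ ι), x ≠ 0 →
      Matrix.toEuclideanCLM (𝕜 := ℂ) G x = μ • x →
      x.ofLp ≠ 0 ∧ G *ᵥ x.ofLp = μ • x.ofLp := fun μ x hx h =>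
    ⟨by simpa using hx, by simpa using congrArg WithLp.ofLp h⟩
  obtain ⟨S, hS, ⟨c, hc, hcS⟩, hneg⟩ := exists_lyapunov_operator _ (EuclideanSpace ℂ ι) rfl
    (Matrix.toEuclideanCLM (𝕜 := ℂ) G)
    fun μ x hx h => hG μ x.ofLp (heig μ x hx h).1 (heig μ x hx h).2
  obtain ⟨S, rfl⟩ := (Matrix.toEuclideanCLM (n := ι) (𝕜 := ℂ)).surjective S
  have hform : ∀ (M : Matrix ι ι ℂ) (v : ι → ℂ), star v ⬝ᵥ M *ᵥ v =
      inner ℂ (WithLp.toLp 2 v) (Matrix.toEuclideanCLM (𝕜 := ℂ) M (WithLp.toLp 2 v)) := by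
    intro M v
    rw [EuclideanSpace.inner_eq_star_dotProduct, dotProduct_comm]; simp
  have hpos : ∀ v : ι → ℂ, v ≠ 0 → 0 < ‖WithLp.toLp 2 v‖ := fun v hv => by
    rw [norm_pos_iff]; simpa using hv
  refine ⟨S, ?_, fun v hv => ?_, fun h v hv => ?_⟩
  · rw [← Matrix.isSymmetric_toEuclideanLin_iff]
    exact fun x y => hS x y
  · rw [hform, map_mul]
    have := hpos v hv
    exact lt_of_lt_of_le (by positivity) (hcS (WithLp.toLp 2 v))
  · obtain ⟨c', hc', h'⟩ := hneg fun μ x hx hx' => h μ x.ofLp (heig μ x hx hx').1 (heig μ x hx hx').2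
    rw [hform, map_neg, neg_apply, inner_neg_right, Complex.neg_re]
    have := hpos v hv
    exact lt_of_lt_of_le (by positivity) (h' (WithLp.toLp 2 v))

/-! ### Stability of accretivity under perturbation -/

/-- Accretivity is an open condition, with a locally uniform lower bound. -/
theorem Accretive.eventually {ι : Type*} [Fintype ι] {M : Matrix ι ι ℂ} (hM : Accretive M) :
    ∃ c > 0, ∀ᶠ M' in 𝓝 M, ∀ v : ι → ℂ, c * ‖v‖ ^ 2 ≤ (star v ⬝ᵥ M' *ᵥ v).re := by
  have hcont : Continuous fun p : Matrix ι ι ℂ × (ι → ℂ) => (star p.2 ⬝ᵥ p.1 *ᵥ p.2).re := by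
    fun_prop
  have hcomp : IsCompact (Metric.sphere (0 : ι → ℂ) 1) := isCompact_sphere _ _
  obtain ⟨c, hc, hcM⟩ : ∃ c > 0, ∀ v ∈ Metric.sphere (0 : ι → ℂ) 1,
      c < (star v ⬝ᵥ M *ᵥ v).re := by
    rcases (Metric.sphere (0 : ι → ℂ) 1).eq_empty_or_nonempty with h | h
    · exact ⟨1, one_pos, by simp [h]⟩
    · obtain ⟨v₀, hv₀, hmin⟩ := hcomp.exists_isMinOn h
        (f := fun v => (star v ⬝ᵥ M *ᵥ v).re)
        (hcont.comp (Continuous.prodMk continuous_const continuous_id)).continuousOn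
      have hpos := hM v₀ (ne_zero_of_mem_unit_sphere ⟨v₀, hv₀⟩)
      refine ⟨_, half_pos hpos, fun v hv => lt_of_lt_of_le (half_lt_self hpos) (hmin hv)⟩
  refine ⟨c, hc, ?_⟩
  have hev : ∀ᶠ M' in 𝓝 M, ∀ v ∈ Metric.sphere (0 : ι → ℂ) 1, c < (star v ⬝ᵥ M' *ᵥ v).re :=
    hcomp.eventually_forall_of_forall_eventually fun v hv =>
      hcont.continuousAt.eventually (lt_mem_nhds (hcM v hv))
  filter_upwards [hev] with M' hM' v
  rcases eq_or_ne v 0 with rfl | hv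
  · simp
  have hv0 : 0 < ‖v‖ := norm_pos_iff.mpr hv
  have h1 := hM' (((‖v‖⁻¹ : ℝ) : ℂ) • v) (by
    rw [mem_sphere_zero_iff_norm, norm_smul]; simp [hv0.ne'])
  have h2 : (star (((‖v‖⁻¹ : ℝ) : ℂ) • v) ⬝ᵥ M' *ᵥ (((‖v‖⁻¹ : ℝ) : ℂ) • v)).re
      = (‖v‖ ^ 2)⁻¹ * (star v ⬝ᵥ M' *ᵥ v).re := by
    rw [Matrix.mulVec_smul, star_smul, smul_dotProduct, dotProduct_smul, smul_smul, smul_eq_mul,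
      ← Complex.re_ofReal_mul]
    congr 2
    simp [sq]
  rw [h2, inv_mul_eq_div, lt_div_iff₀ (by positivity)] at h1
  exact h1.le

theorem exists_mulVec_bound {ι : Type*} [Fintype ι] (M : Matrix ι ι ℂ) :
    ∃ D, 0 ≤ D ∧ ∀ᶠ M' in 𝓝 M, ∀ v : ι → ℂ, ‖M' *ᵥ v‖ ≤ D * ‖v‖ := by
  refine ⟨∑ i, ∑ j, (‖M i j‖ + 1), by positivity, ?_⟩
  have hev : ∀ᶠ M' in 𝓝 M, ∀ i j, ‖M' i j‖ < ‖M i j‖ + 1 := by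
    simp only [eventually_all]
    intro i j
    have hc : Continuous fun M' : Matrix ι ι ℂ => ‖M' i j‖ := by fun_prop
    exact hc.continuousAt.eventually (gt_mem_nhds (lt_add_one _))
  filter_upwards [hev] with M' hM' v
  refine (pi_norm_le_iff_of_nonneg (by positivity)).mpr fun i => ?_
  calc ‖(M' *ᵥ v) i‖ ≤ ∑ j, ‖M' i j * v j‖ := norm_sum_le _ _
    _ ≤ ∑ j, (‖M i j‖ + 1) * ‖v‖ := by
        refine Finset.sum_le_sum fun j _ => ?_
        rw [norm_mul]
        gcongr
        · exact (hM' i j).le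
        · exact norm_le_pi_norm v j
    _ = (∑ j, (‖M i j‖ + 1)) * ‖v‖ := by rw [Finset.sum_mul]
    _ ≤ _ := by
        refine mul_le_mul_of_nonneg_right ?_ (norm_nonneg _)
        exact Finset.single_le_sum (f := fun i => ∑ j, (‖M i j‖ + 1))
          (fun i _ => by positivity) (Finset.mem_univ i)

/-! ### Hyperbolic pencils -/

/-- A **Kreiss symmetrizer** for the system `(N v)' = M v`: if the pencil has no purely imaginary
mode `M v = iξ N v`, then along solutions the quadratic form `(N v)ᴴ S (N v)` has a positive definite
derivative. It is a Lyapunov matrix of `M N⁻¹`. -/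
theorem exists_pencil_symmetrizer {ι : Type} [Fintype ι] [DecidableEq ι] (N M : Matrix ι ι ℂ)
    (hN : IsUnit N.det)
    (h : ∀ (ξ : ℝ) (v : ι → ℂ), v ≠ 0 → M *ᵥ v ≠ (Complex.I * ξ) • N *ᵥ v) :
    ∃ S : Matrix ι ι ℂ, S.IsHermitian ∧ Accretive (Nᴴ * S * M) := by
  obtain ⟨S, hS, hacc, -⟩ := exists_lyapunov_matrix (M * N⁻¹) (fun μ x hx hμ hre => by
    have hNx : N *ᵥ (N⁻¹ *ᵥ x) = x := by
      rw [Matrix.mulVec_mulVec, Matrix.mul_nonsing_inv _ hN, Matrix.one_mulVec]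
    refine h μ.im (N⁻¹ *ᵥ x) (fun h0 => hx (by rw [← hNx, h0, Matrix.mulVec_zero])) ?_
    rw [Matrix.mulVec_mulVec, hμ, hNx]
    congr 1
    apply Complex.ext <;> simp [hre])
  refine ⟨S, hS, fun v hv => ?_⟩
  have hNv : N *ᵥ v ≠ 0 := fun h0 => hv (by
    rw [← Matrix.one_mulVec v, ← Matrix.nonsing_inv_mul _ hN, ← Matrix.mulVec_mulVec, h0,
      Matrix.mulVec_zero])
  have := hacc _ hNv
  rwa [Matrix.star_mulVec, ← Matrix.dotProduct_mulVec, Matrix.mulVec_mulVec, Matrix.mulVec_mulVec,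
    ← Matrix.mul_assoc, Matrix.mul_assoc (Nᴴ * S),
    Matrix.mul_assoc M, Matrix.nonsing_inv_mul _ hN, Matrix.mul_one] at this

/-- Along a compact family of hyperbolic pencils, each member has a symmetrizer that keeps working
on a neighbourhood of the base coefficient which does not depend on the member. -/
theorem exists_uniform_pencil_symmetrizer {ι X E : Type} [Fintype ι] [DecidableEq ι]
    [TopologicalSpace X] [TopologicalSpace E] {K : Set X} (hK : IsCompact K) (e₀ : E)
    (N M : X × E → Matrix ι ι ℂ) (hNc : Continuous N) (hMc : Continuous M)
    (hN : ∀ k ∈ K, IsUnit (N (k, e₀)).det)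
    (h : ∀ k ∈ K, ∀ (ξ : ℝ) (v : ι → ℂ), v ≠ 0 →
      M (k, e₀) *ᵥ v ≠ (Complex.I * ξ) • N (k, e₀) *ᵥ v) :
    ∃ O ∈ 𝓝 e₀, ∀ k ∈ K, ∃ S : Matrix ι ι ℂ, S.IsHermitian ∧ ∃ c > 0, ∃ D, ∀ e ∈ O, ∀ v : ι → ℂ,
      c * ‖v‖ ^ 2 ≤ (star (N (k, e) *ᵥ v) ⬝ᵥ S *ᵥ (M (k, e) *ᵥ v)).re ∧
        ‖N (k, e) *ᵥ v‖ ≤ D * ‖v‖ := by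
  refine hK.induction_on (p := fun s => ∃ O ∈ 𝓝 e₀, ∀ k ∈ s, ∃ S : Matrix ι ι ℂ, S.IsHermitian ∧
    ∃ c > 0, ∃ D, ∀ e ∈ O, ∀ v : ι → ℂ,
      c * ‖v‖ ^ 2 ≤ (star (N (k, e) *ᵥ v) ⬝ᵥ S *ᵥ (M (k, e) *ᵥ v)).re ∧
        ‖N (k, e) *ᵥ v‖ ≤ D * ‖v‖) ?_ ?_ ?_ ?_
  · exact ⟨univ, univ_mem, by simp⟩
  · rintro s t hst ⟨O, hO, hO'⟩
    exact ⟨O, hO, fun k hk => hO' k (hst hk)⟩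
  · rintro s t ⟨O, hO, hO'⟩ ⟨O₁, hO₁, hO₁'⟩
    refine ⟨O ∩ O₁, inter_mem hO hO₁, ?_⟩
    rintro k (hk | hk)
    · obtain ⟨S, hS, c, hc, D, H⟩ := hO' k hk
      exact ⟨S, hS, c, hc, D, fun e he => H e he.1⟩
    · obtain ⟨S, hS, c, hc, D, H⟩ := hO₁' k hk
      exact ⟨S, hS, c, hc, D, fun e he => H e he.2⟩
  · intro k hk
    obtain ⟨S, hS, hacc⟩ := exists_pencil_symmetrizer _ _ (hN k hk) (h k hk)
    obtain ⟨c, hc, hev⟩ := hacc.eventually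
    have hcont : Continuous fun p : X × E => (N p)ᴴ * S * M p := by fun_prop
    obtain ⟨D, -, hDev⟩ := exists_mulVec_bound (N (k, e₀))
    have hev' := (hcont.continuousAt.eventually hev).and (hNc.continuousAt.eventually hDev)
    rw [nhds_prod_eq, eventually_prod_iff] at hev'
    obtain ⟨pk, hpk, pe, hpe, H⟩ := hev'
    refine ⟨{k | pk k}, mem_nhdsWithin_of_mem_nhds hpk, {e | pe e}, hpe, fun k' hk' =>
      ⟨S, hS, c, hc, D, fun e he v => ⟨?_, (H hk' he).2 v⟩⟩⟩
    have := (H hk' he).1 v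
    rwa [← Matrix.mulVec_mulVec, ← Matrix.mulVec_mulVec, Matrix.dotProduct_mulVec,
      ← Matrix.star_mulVec] at this

/-! ### Energy functionals along solutions on the line -/

/-- A function with `V' ≥ κ V` that is positive somewhere grows exponentially to the right, which is
incompatible with a bound by an integrable function plus a quadratic polynomial. -/
theorem nonpos_of_expanding {V V' g : ℝ → ℝ} {κ C : ℝ} (hκ : 0 < κ)
    (hV : ∀ x, HasDerivAt V (V' x) x) (h : ∀ x, κ * V x ≤ V' x) (hg : Integrable g)
    (hb : ∀ x, V x ≤ g x + C * (1 + |x|) ^ 2) (x₁ : ℝ) : V x₁ ≤ 0 := by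
  by_contra! hpos
  have hderiv : ∀ x, HasDerivAt (fun x => Real.exp (-(κ * x)) * V x)
      (Real.exp (-(κ * x)) * (V' x - κ * V x)) x := fun x => by
    have h1 : HasDerivAt (fun x => Real.exp (-(κ * x))) (Real.exp (-(κ * x)) * (-(κ * 1))) x :=
      (((hasDerivAt_id x).const_mul κ).neg).exp
    exact (h1.mul (hV x)).congr_deriv (by ring)
  have hmono : Monotone fun x => Real.exp (-(κ * x)) * V x :=
    monotone_of_deriv_nonneg (fun x => (hderiv x).differentiableAt) fun x => by
      rw [(hderiv x).deriv]
      exact mul_nonneg (Real.exp_nonneg _) (sub_nonneg.mpr (h x))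
  set a := Real.exp (-(κ * x₁)) * V x₁
  have ha0 : 0 < a := by positivity
  have hgrow : ∀ x, x₁ ≤ x → a * Real.exp (κ * x) ≤ V x := fun x hx => by
    have h1 : a ≤ Real.exp (-(κ * x)) * V x := hmono hx
    calc a * Real.exp (κ * x) ≤ Real.exp (-(κ * x)) * V x * Real.exp (κ * x) := by gcongr
      _ = V x := by rw [Real.exp_neg]; field_simp
  have hlittle := (isLittleO_pow_exp_pos_mul_atTop 2 hκ).def
    (show 0 < a / (4 * |C| + 1) by positivity)
  -- the exponential beats the quadratic term, so `g ≥ 1` near infinity and is not integrable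
  have hlarge : ∀ᶠ x in atTop, 1 ≤ g x := by
    filter_upwards [hlittle, eventually_ge_atTop 1, eventually_ge_atTop x₁] with x hx hx1 hx2
    have h1 := hgrow x hx2
    rw [Real.norm_of_nonneg (by positivity), Real.norm_of_nonneg (Real.exp_nonneg _),
      div_mul_eq_mul_div, le_div_iff₀ (by positivity)] at hx
    have h2 := hb x
    rw [abs_of_nonneg (by linarith)] at h2
    have h3 : C * (1 + x) ^ 2 ≤ |C| * (4 * x ^ 2) := by
      have : (1 + x) ^ 2 ≤ 4 * x ^ 2 := by nlinarith
      calc C * (1 + x) ^ 2 ≤ |C| * (1 + x) ^ 2 := by gcongr; exact le_abs_self C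
        _ ≤ _ := by gcongr
    nlinarith
  obtain ⟨X, hX⟩ := eventually_atTop.mp hlarge
  have hint : IntegrableOn (fun _ : ℝ => (1 : ℝ)) (Ioi X) :=
    hg.integrableOn.mono' aestronglyMeasurable_const
      ((ae_restrict_mem measurableSet_Ioi).mono fun x hx => by
        simpa using hX x (le_of_lt hx))
  rw [integrableOn_const_iff] at hint
  simp at hint

/-- A function that expands exponentially in both directions but is bounded by an integrable
function plus a quadratic polynomial vanishes. -/
theorem eq_zero_of_expanding {V V' g : ℝ → ℝ} {κ C : ℝ} (hκ : 0 < κ)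
    (hV : ∀ x, HasDerivAt V (V' x) x) (h : ∀ x, κ * |V x| ≤ V' x) (hg : Integrable g)
    (hb : ∀ x, |V x| ≤ g x + C * (1 + |x|) ^ 2) (x : ℝ) : V x = 0 := by
  refine le_antisymm (nonpos_of_expanding hκ hV (fun x => le_trans ?_ (h x)) hg
    (fun x => (le_abs_self _).trans (hb x)) x) ?_
  · gcongr; exact le_abs_self _
  · have := nonpos_of_expanding (V := fun x => -V (-x)) (V' := fun x => V' (-x))
      (g := fun x => g (-x)) (C := C) hκ (fun x => ?_) (fun x => ?_) hg.comp_neg (fun x => ?_) (-x)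
    · simpa using this
    · have := ((hV (-x)).scomp x (hasDerivAt_neg x)).neg
      exact this.congr_deriv (by simp)
    · exact le_trans (by gcongr; exact neg_le_abs _) (h (-x))
    · simpa using (neg_le_abs _).trans (hb (-x))

/-- If the energy `V` is controlled by `‖v‖²` and grows at least at the rate `‖v‖²`, then `v`
vanishes as soon as `V` does not grow exponentially. -/
theorem eq_zero_of_energy {E : Type*} [NormedAddCommGroup E] {v : ℝ → E} {V V' g : ℝ → ℝ}
    {c C D : ℝ} (hc : 0 < c)
    (hV : ∀ x, HasDerivAt V (V' x) x) (h : ∀ x, c * ‖v x‖ ^ 2 ≤ V' x)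
    (hVv : ∀ x, |V x| ≤ D * ‖v x‖ ^ 2) (hg : Integrable g)
    (hb : ∀ x, |V x| ≤ g x + C * (1 + |x|) ^ 2) : v = 0 := by
  have hzero := eq_zero_of_expanding (κ := c / (|D| + 1)) (by positivity) hV (fun x => by
    refine le_trans ?_ (h x)
    rw [div_mul_eq_mul_div, div_le_iff₀ (by positivity), mul_assoc]
    gcongr
    have h1 := hVv x
    have h2 : D * ‖v x‖ ^ 2 ≤ |D| * ‖v x‖ ^ 2 := by gcongr; exact le_abs_self D
    nlinarith [sq_nonneg ‖v x‖]) hg hb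
  funext x
  have h1 : V' x = 0 := by
    have := hV x
    rw [show V = fun _ => 0 from funext hzero] at this
    exact this.unique (hasDerivAt_const x 0)
  have h2 := h x
  rw [h1] at h2
  have h3 : ‖v x‖ ^ 2 = 0 := le_antisymm (by nlinarith) (sq_nonneg _)
  simpa using h3

open scoped Interval in
/-- A primitive of an `L²` function grows at most linearly. -/
theorem exists_linear_growth {E : Type*} [NormedAddCommGroup E] [NormedSpace ℂ E] [CompleteSpace E]
    {φ w : ℝ → E} {lam : ℂ} (hw : Continuous w) (hw2 : MemLp w 2 volume)
    (hφ : ∀ x, HasDerivAt φ (lam • w x) x) : ∃ C, 0 ≤ C ∧ ∀ x, ‖φ x‖ ≤ C * (1 + |x|) := by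
  have hint : Integrable fun x => ‖w x‖ ^ 2 := hw2.integrable_norm_pow two_ne_zero
  set J := ∫ x, ‖w x‖ ^ 2
  have hJ0 : 0 ≤ J := integral_nonneg fun x => by positivity
  refine ⟨‖φ 0‖ + ‖lam‖ * (1 + J), by positivity, fun x => ?_⟩
  have hcw : Continuous fun x => lam • w x := by fun_prop
  have h1 : φ x = φ 0 + ∫ t in (0 : ℝ)..x, lam • w t := by
    rw [intervalIntegral.integral_eq_sub_of_hasDerivAt (fun t _ => hφ t)
      (hcw.intervalIntegrable _ _)]
    abel
  have h2 : ‖∫ t in (0 : ℝ)..x, lam • w t‖ ≤ ∫ t in Ι 0 x, ‖lam‖ * (1 + ‖w t‖ ^ 2) := by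
    refine intervalIntegral.norm_integral_le_integral_norm_uIoc.trans ?_
    refine setIntegral_mono ?_ ?_ fun t => ?_
    · exact (hcw.norm.intervalIntegrable 0 x).def'
    · exact ((by fun_prop : Continuous fun t => ‖lam‖ * (1 + ‖w t‖ ^ 2)).intervalIntegrable
        0 x).def'
    · simp only [norm_smul]
      gcongr
      nlinarith [sq_nonneg (‖w t‖ - 1)]
  have h3 : ∫ t in Ι 0 x, ‖lam‖ * (1 + ‖w t‖ ^ 2) ≤ ‖lam‖ * (|x| + J) := by
    rw [integral_const_mul, integral_add]
    · gcongr
      · simp [uIoc, Real.volume_real_Ioc, max_sub_min_eq_abs]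
      · exact setIntegral_le_integral hint (Eventually.of_forall fun t => by positivity)
    · exact (continuous_const.intervalIntegrable 0 x).def'
    · exact hint.integrableOn
  rw [h1]
  refine (norm_add_le _ _).trans ?_
  have h4 := h2.trans h3
  have e : (‖φ 0‖ + ‖lam‖ * (1 + J)) * (1 + |x|) = ‖φ 0‖ + ‖lam‖ * (|x| + J)
    + (‖φ 0‖ * |x| + ‖lam‖ * 1 + ‖lam‖ * J * |x|) := by ring
  have h8 : 0 ≤ ‖φ 0‖ * |x| + ‖lam‖ * 1 + ‖lam‖ * J * |x| := by positivity
  linarith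

/-! ### From thresholds to a modulus -/

/-- If, for every `δ > 0`, all `λ` in the right half-plane with property `P ε` satisfy `‖λ‖ ≤ δ` for
small `ε`, then the supremum of these `‖λ‖` is a modulus `r(ε) → 0`. -/
theorem exists_modulus {P : ℝ → ℂ → Prop} {ε₀ : ℝ} (hε₀ : 0 < ε₀)
    (h : ∀ δ > 0, ∀ᶠ ε in 𝓝[>] (0 : ℝ), ∀ lam : ℂ, 0 ≤ lam.re → P ε lam → ‖lam‖ ≤ δ) :
    ∃ ε₁ ∈ Ioc 0 ε₀, ∃ r : ℝ → ℝ, Tendsto r (𝓝[>] (0 : ℝ)) (𝓝 0) ∧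
      ∀ ε ∈ Ioo 0 ε₁, ∀ lam : ℂ, 0 ≤ lam.re → P ε lam → ‖lam‖ ≤ r ε := by
  obtain ⟨ε₁, hε₁, hsub⟩ := mem_nhdsGT_iff_exists_Ioo_subset.mp (h 1 one_pos)
  let T : ℝ → Set ℝ := fun ε => {t | ∃ lam : ℂ, 0 ≤ lam.re ∧ P ε lam ∧ t = ‖lam‖}
  refine ⟨min ε₁ ε₀, ⟨lt_min hε₁ hε₀, min_le_right _ _⟩, fun ε => sSup (T ε), ?_, ?_⟩
  · rw [Metric.tendsto_nhds]
    intro δ hδ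
    filter_upwards [h (δ / 2) (half_pos hδ)] with ε hε
    have h0 : 0 ≤ sSup (T ε) := Real.sSup_nonneg (by rintro _ ⟨lam, -, -, rfl⟩; positivity)
    rw [Real.dist_eq, sub_zero, abs_of_nonneg h0]
    refine lt_of_le_of_lt (Real.sSup_le ?_ (half_pos hδ).le) (half_lt_self hδ)
    rintro _ ⟨lam, hre, hP, rfl⟩
    exact hε lam hre hP
  · intro ε hε lam hre hP
    refine le_csSup ⟨1, ?_⟩ ⟨lam, hre, hP, rfl⟩
    rintro _ ⟨lam', hre', hP', rfl⟩
    exact hsub ⟨hε.1, hε.2.trans_le (min_le_left _ _)⟩ lam' hre' hP'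

/-! ### Bounded solutions of almost constant equations -/

theorem exists_pos_mul_norm_le {E F : Type*} [NormedAddCommGroup E] [NormedSpace ℝ E]
    [FiniteDimensional ℝ E] [NormedAddCommGroup F] [NormedSpace ℝ F] (T : E →L[ℝ] F)
    (hT : Function.Injective T) : ∃ b > 0, ∀ v, b * ‖v‖ ≤ ‖T v‖ := by
  obtain ⟨K, hK, h⟩ := (T : E →ₗ[ℝ] F).exists_antilipschitzWith (LinearMap.ker_eq_bot.mpr hT)
  refine ⟨(K : ℝ)⁻¹, by positivity, fun v => ?_⟩
  have := h.le_mul_dist v 0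
  simp only [map_zero, dist_zero_right] at this
  rw [inv_mul_le_iff₀ (by exact_mod_cast hK)]
  exact this

/-- A nearly constant function `u` with `B u' ≈ e`, `B ≈ B₀`, has small derivative: were `e` not
small, `B₀ u` would drift by about `e` over an interval of length one. -/
theorem norm_deriv_le_of_nearly_const {E : Type*} [NormedAddCommGroup E] [NormedSpace ℝ E]
    {B₀ : E →L[ℝ] E} {b σ : ℝ} (hb : 0 < b) (hB₀ : ∀ v, b * ‖v‖ ≤ ‖B₀ v‖) (hσb : 4 * σ ≤ b)
    {u u' : ℝ → E} {u₀ e : E} {B : ℝ → E →L[ℝ] E} (hu' : ∀ x, HasDerivAt u (u' x) x)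
    (hB : ∀ x, ‖B x - B₀‖ ≤ σ) (hu : ∀ x, ‖u x - u₀‖ ≤ σ) (he : ∀ x, ‖B x (u' x) - e‖ ≤ σ)
    (x : ℝ) : ‖u' x‖ ≤ 2 / b * (4 * ‖B₀‖ + 5) * σ := by
  have hσ : 0 ≤ σ := (norm_nonneg _).trans (hu 0)
  have hr : ∀ x, ‖B₀ (u' x) - e‖ ≤ σ * ‖u' x‖ + σ := fun x => by
    have h1 : B₀ (u' x) - e = -((B x - B₀) (u' x)) + (B x (u' x) - e) := by simp
    rw [h1]
    refine (norm_add_le _ _).trans ?_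
    rw [norm_neg]
    gcongr
    · exact ((B x - B₀).le_opNorm _).trans (by gcongr; exact hB x)
    · exact he x
  have hu'b : ∀ x, ‖u' x‖ ≤ 2 / b * (‖e‖ + σ) := fun x => by
    have h1 : ‖B₀ (u' x)‖ ≤ ‖e‖ + (σ * ‖u' x‖ + σ) := by
      have := norm_le_norm_add_norm_sub e (B₀ (u' x))
      rw [norm_sub_rev] at this
      linarith [hr x]
    have h2 := hB₀ (u' x)
    rw [div_mul_eq_mul_div, le_div_iff₀ hb]
    nlinarith [norm_nonneg (u' x)]
  set ρ := σ * (2 / b * (‖e‖ + σ)) + σ with hρ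
  have hdrift : ‖(B₀ (u 1) - (1 : ℝ) • e) - (B₀ (u 0) - (0 : ℝ) • e)‖ ≤ ρ * ‖(1 : ℝ) - 0‖ := by
    refine Convex.norm_image_sub_le_of_norm_hasDerivWithin_le
      (f := fun x : ℝ => B₀ (u x) - x • e) (f' := fun x => B₀ (u' x) - e) (s := univ)
      (fun x _ => ?_) (fun x _ => ?_) convex_univ (mem_univ _) (mem_univ _)
    · have h1 := B₀.hasFDerivAt.comp_hasDerivAt x (hu' x)
      have h2 := (hasDerivAt_id x).smul_const e
      simp only [one_smul] at h2
      exact (h1.sub h2).hasDerivWithinAt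
    · refine (hr x).trans ?_
      rw [hρ]
      gcongr
      exact hu'b x
  have he' : ‖e‖ ≤ ‖B₀‖ * (2 * σ) + ρ := by
    have h1 : e = (B₀ (u 1 - u₀) - B₀ (u 0 - u₀)) -
        ((B₀ (u 1) - (1 : ℝ) • e) - (B₀ (u 0) - (0 : ℝ) • e)) := by
      simp only [map_sub, one_smul, zero_smul]; abel
    have h2 := B₀.le_opNorm (u 1 - u₀)
    have h3 := B₀.le_opNorm (u 0 - u₀)
    have h4 := mul_le_mul_of_nonneg_left (hu 1) (norm_nonneg B₀)
    have h5 := mul_le_mul_of_nonneg_left (hu 0) (norm_nonneg B₀)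
    have h6 : ‖e‖ ≤ ‖B₀ (u 1 - u₀)‖ + ‖B₀ (u 0 - u₀)‖ + ‖(B₀ (u 1) - (1 : ℝ) • e) -
        (B₀ (u 0) - (0 : ℝ) • e)‖ := by
      conv_lhs => rw [h1]
      exact (norm_sub_le _ _).trans (by gcongr; exact norm_sub_le _ _)
    simp only [sub_zero, norm_one, mul_one] at hdrift
    linarith
  have hhalf : σ * (2 / b * (‖e‖ + σ)) ≤ 1 / 2 * (‖e‖ + σ) := by
    have : σ * (2 / b) ≤ 1 / 2 := by
      rw [← mul_div_assoc, div_le_iff₀ hb]; linarith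
    nlinarith [norm_nonneg e]
  have he2 : ‖e‖ ≤ (4 * ‖B₀‖ + 4) * σ := by
    have := norm_nonneg e
    have h9 : ‖B₀‖ * (2 * σ) = 2 * (‖B₀‖ * σ) := by ring
    have h10 : (4 * ‖B₀‖ + 4) * σ = 4 * (‖B₀‖ * σ) + 4 * σ := by ring
    rw [h10]
    linarith
  refine (hu'b x).trans ?_
  rw [mul_assoc]
  gcongr
  linarith

/-! ### Matrices and quadratic forms -/

theorem mem_spectrum_iff_exists_mulVec {ι : Type*} [Fintype ι] [DecidableEq ι] (M : Matrix ι ι ℂ)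
    (μ : ℂ) : μ ∈ spectrum ℂ M ↔ ∃ v, v ≠ 0 ∧ M *ᵥ v = μ • v := by
  rw [spectrum.mem_iff, Matrix.isUnit_iff_isUnit_det, isUnit_iff_ne_zero, not_not,
    ← Matrix.exists_mulVec_eq_zero_iff]
  refine exists_congr fun v => and_congr_right fun _ => ?_
  rw [Matrix.sub_mulVec, sub_eq_zero, Algebra.algebraMap_eq_smul_one, Matrix.smul_mulVec,
    Matrix.one_mulVec, eq_comm]

theorem cMatrix_apply {ι V : Type*} [Fintype ι] [DecidableEq ι] [NormedAddCommGroup V]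
    [NormedSpace ℝ V] (b : Module.Basis ι ℝ V) (T : V →L[ℝ] V) (i j : ι) :
    cMatrix b T i j = ((b.repr (T (b j)) i : ℝ) : ℂ) := by
  simp [cMatrix, LinearMap.toMatrix_apply]

theorem cMatrix_mulVec_repr {ι V : Type*} [Fintype ι] [DecidableEq ι] [NormedAddCommGroup V]
    [NormedSpace ℝ V] (b : Module.Basis ι ℝ V) (T : V →L[ℝ] V) (v : V) :
    cMatrix b T *ᵥ (fun i => ((b.repr v i : ℝ) : ℂ)) = fun i => ((b.repr (T v) i : ℝ) : ℂ) := by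
  have h := LinearMap.toMatrix_mulVec_repr b b (T : V →ₗ[ℝ] V) v
  funext i
  have h1 := congrFun h i
  simp only [ContinuousLinearMap.coe_coe] at h1
  rw [← h1]
  simp [cMatrix, Matrix.mulVec, dotProduct]

theorem continuous_cMatrix {ι V : Type*} [Fintype ι] [DecidableEq ι] [NormedAddCommGroup V]
    [NormedSpace ℝ V] [FiniteDimensional ℝ V] (b : Module.Basis ι ℝ V) :
    Continuous (cMatrix b) := by
  refine continuous_matrix fun i j => ?_
  simp only [cMatrix_apply]
  have h1 : Continuous (b.coord i) := (b.coord i).continuous_of_finiteDimensional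
  exact Complex.continuous_ofReal.comp (h1.comp (ContinuousLinearMap.apply ℝ V (b j)).continuous)

theorem injective_of_zero_notMem_spectrum {ι V : Type*} [Fintype ι] [DecidableEq ι]
    [NormedAddCommGroup V] [NormedSpace ℝ V] (b : Module.Basis ι ℝ V) (T : V →L[ℝ] V)
    (h : (0 : ℂ) ∉ spectrum ℂ (cMatrix b T)) : Function.Injective T := by
  rw [injective_iff_map_eq_zero]
  intro v hv
  by_contra hv0
  refine h ((mem_spectrum_iff_exists_mulVec _ _).mpr
    ⟨fun i => ((b.repr v i : ℝ) : ℂ), fun h0 => hv0 ?_, ?_⟩)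
  · rw [← b.repr.map_eq_zero_iff]
    ext i
    simpa using congrFun h0 i
  · rw [cMatrix_mulVec_repr, hv]
    ext i
    simp

theorem norm_star_dotProduct_le {ι : Type*} [Fintype ι] (v w : ι → ℂ) :
    ‖star v ⬝ᵥ w‖ ≤ Fintype.card ι * (‖v‖ * ‖w‖) := by
  calc ‖star v ⬝ᵥ w‖ ≤ ∑ i, ‖star v i * w i‖ := norm_sum_le _ _
    _ ≤ ∑ _i : ι, ‖v‖ * ‖w‖ := by
        refine Finset.sum_le_sum fun i _ => ?_
        rw [norm_mul, Pi.star_apply, norm_star]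
        gcongr
        · exact norm_le_pi_norm v i
        · exact norm_le_pi_norm w i
    _ = _ := by simp

theorem Matrix.IsHermitian.star_dotProduct_mulVec {ι : Type*} [Fintype ι] {S : Matrix ι ι ℂ}
    (hS : S.IsHermitian) (v w : ι → ℂ) :
    star v ⬝ᵥ S *ᵥ w = starRingEnd ℂ (star w ⬝ᵥ S *ᵥ v) := by
  rw [star_dotProduct, Matrix.star_mulVec, hS.eq, ← Matrix.dotProduct_mulVec]
  rfl

/-- The derivative of the energy `Re zᴴ S z`. -/
theorem hasDerivAt_dotProduct_mulVec {ι : Type*} [Fintype ι] {S : ℝ → Matrix ι ι ℂ}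
    {S' : Matrix ι ι ℂ} {z : ℝ → ι → ℂ} {z' : ι → ℂ} {x : ℝ}
    (hS : ∀ i j, HasDerivAt (fun y => S y i j) (S' i j) x) (hz : HasDerivAt z z' x)
    (hH : (S x).IsHermitian) :
    HasDerivAt (fun y => (star (z y) ⬝ᵥ S y *ᵥ z y).re)
      (2 * (star (z x) ⬝ᵥ S x *ᵥ z').re + (star (z x) ⬝ᵥ S' *ᵥ z x).re) x := by
  rw [hasDerivAt_pi] at hz
  have h1 : HasDerivAt (fun y => star (z y) ⬝ᵥ S y *ᵥ z y)
      (star z' ⬝ᵥ S x *ᵥ z x + star (z x) ⬝ᵥ (S' *ᵥ z x + S x *ᵥ z')) x := by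
    simp only [dotProduct, Matrix.mulVec, ← Finset.sum_add_distrib, Pi.star_apply, Pi.add_apply]
    refine HasDerivAt.fun_sum fun i _ => (hz i).star.mul ?_
    exact HasDerivAt.fun_sum fun j _ => (hS i j).mul (hz j)
  have h2 := Complex.reCLM.hasFDerivAt.comp_hasDerivAt x h1
  refine h2.congr_deriv ?_
  have h3 : (star z' ⬝ᵥ S x *ᵥ z x).re = (star (z x) ⬝ᵥ S x *ᵥ z').re := by
    rw [hH.star_dotProduct_mulVec, Complex.conj_re]
  simp only [Complex.reCLM_apply, Complex.add_re, dotProduct_add, h3]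
  ring

/-- Energy argument for a symmetrized pencil: solutions of `(N v)' = ρ M v` without exponential
growth vanish. -/
theorem eq_zero_of_pencil {ι : Type} [Fintype ι] {S : Matrix ι ι ℂ} (hS : S.IsHermitian)
    {N M : ℝ → Matrix ι ι ℂ} {v : ℝ → ι → ℂ} {c ρ D C : ℝ} {g : ℝ → ℝ} (hc : 0 < c) (hρ : 0 < ρ)
    (hacc : ∀ x, c * ‖v x‖ ^ 2 ≤ (star (N x *ᵥ v x) ⬝ᵥ S *ᵥ (M x *ᵥ v x)).re)
    (hD : ∀ x, ‖N x *ᵥ v x‖ ≤ D * ‖v x‖) (hg : Integrable g)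
    (hgrow : ∀ x, ‖N x *ᵥ v x‖ ^ 2 ≤ g x + C * (1 + |x|) ^ 2)
    (hode : ∀ x, HasDerivAt (fun y => N y *ᵥ v y) ((ρ : ℂ) • (M x *ᵥ v x)) x) : v = 0 := by
  obtain ⟨K, hK, hKev⟩ := exists_mulVec_bound S
  have hSb := hKev.self_of_nhds
  set m : ℝ := (Fintype.card ι : ℝ)
  have hVb : ∀ x, |(star (N x *ᵥ v x) ⬝ᵥ S *ᵥ (N x *ᵥ v x)).re| ≤ m * K * ‖N x *ᵥ v x‖ ^ 2 := by
    intro x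
    refine (Complex.abs_re_le_norm _).trans ((norm_star_dotProduct_le _ _).trans ?_)
    calc m * (‖N x *ᵥ v x‖ * ‖S *ᵥ (N x *ᵥ v x)‖)
        ≤ m * (‖N x *ᵥ v x‖ * (K * ‖N x *ᵥ v x‖)) := by gcongr; exact hSb _
      _ = _ := by ring
  refine eq_zero_of_energy (c := 2 * ρ * c) (D := m * K * D ^ 2) (C := m * K * C)
    (g := fun x => m * K * g x) (by positivity)
    (fun x => hasDerivAt_dotProduct_mulVec (S := fun _ => S) (S' := 0)
      (fun i j => hasDerivAt_const x _) (hode x) hS) (fun x => ?_) (fun x => ?_)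
    (hg.const_mul _) (fun x => ?_)
  · have h1 : (star (N x *ᵥ v x) ⬝ᵥ S *ᵥ ((ρ : ℂ) • M x *ᵥ v x)).re =
        ρ * (star (N x *ᵥ v x) ⬝ᵥ S *ᵥ (M x *ᵥ v x)).re := by
      rw [Matrix.mulVec_smul, dotProduct_smul, smul_eq_mul, Complex.re_ofReal_mul]
    rw [h1, Matrix.zero_mulVec, dotProduct_zero, Complex.zero_re, add_zero]
    have := mul_le_mul_of_nonneg_left (hacc x) (by positivity : 0 ≤ 2 * ρ)
    linarith
  · refine (hVb x).trans ?_
    rw [mul_assoc (m * K), ← mul_pow]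
    gcongr
    exact hD x
  · refine (hVb x).trans ?_
    have h1 : m * K * g x + m * K * C * (1 + |x|) ^ 2 = m * K * (g x + C * (1 + |x|) ^ 2) := by ring
    rw [h1]
    gcongr
    exact hgrow x

theorem TendstoUniformly.eventually_forall_mem {α β γ : Type*} [UniformSpace β] {F : α → γ → β}
    {a : β} {l : Filter α} (h : TendstoUniformly F (fun _ => a) l) {O : Set β} (hO : O ∈ 𝓝 a) :
    ∀ᶠ i in l, ∀ x, F i x ∈ O := by
  rw [UniformSpace.mem_nhds_iff] at hO
  obtain ⟨V, hV, hVO⟩ := hO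
  filter_upwards [h V hV] with i hi x
  exact hVO (hi x)

/-! ### Viscous profiles -/

section Viscous

variable {n : ℕ} {f : RVec n → RVec n} {B : RVec n → RVec n →L[ℝ] RVec n} {U : Set (RVec n)}
  {u₀ : RVec n}

theorem ViscousHypotheses.injective (H : ViscousHypotheses f B U u₀) :
    Function.Injective (B u₀) :=
  injective_of_zero_notMem_spectrum (stdBasis n) _ fun h => by simpa using H.parabolic 0 h

/-- Profiles that are uniformly close to `u₀` have uniformly small derivatives. -/
theorem ViscousHypotheses.eventually_norm_deriv_le (H : ViscousHypotheses f B U u₀)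
    {ubar : ℝ → ℝ → RVec n} {um up : ℝ → RVec n} {l : Filter ℝ}
    (hprof : ∀ᶠ ε in l, IsViscousProfile f B U (ubar ε) (um ε) (up ε))
    (hunif : TendstoUniformly ubar (fun _ => u₀) l) {η : ℝ} (hη : 0 < η) :
    ∀ᶠ ε in l, ∀ x, ‖deriv (ubar ε) x‖ ≤ η := by
  obtain ⟨b, hb, hbB⟩ := exists_pos_mul_norm_le (B u₀) H.injective
  set q := 2 / b * (4 * ‖B u₀‖ + 5)
  have hq0 : 0 < q := by positivity
  set σ := min (b / 4) (η / q)
  have hσ0 : 0 < σ := by positivity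
  have hU : U ∈ 𝓝 u₀ := H.isOpen.mem_nhds H.mem
  have hBc : ContinuousAt B u₀ := H.contDiff_B.continuousOn.continuousAt hU
  have hfc : ContinuousAt f u₀ := H.contDiff_f.continuousOn.continuousAt hU
  have hO1 : {u | ‖B u - B u₀‖ < σ} ∈ 𝓝 u₀ := by
    have := Metric.tendsto_nhds.mp hBc σ hσ0
    simp only [dist_eq_norm] at this
    exact this
  have hO2 : {u | ‖f u - f u₀‖ < σ} ∈ 𝓝 u₀ := by
    have := Metric.tendsto_nhds.mp hfc σ hσ0
    simp only [dist_eq_norm] at this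
    exact this
  have hO3 : {u | ‖u - u₀‖ < σ} ∈ 𝓝 u₀ := by
    have := Metric.ball_mem_nhds u₀ hσ0
    simpa only [Metric.ball, dist_eq_norm] using this
  filter_upwards [hprof, hunif.eventually_forall_mem hO1, hunif.eventually_forall_mem hO2,
    hunif.eventually_forall_mem hO3] with ε hp h1 h2 h3 x
  -- the viscous flux is constant along the profile
  set k := B (ubar ε 0) (deriv (ubar ε) 0) - f (ubar ε 0)
  have hconst : ∀ y, B (ubar ε y) (deriv (ubar ε) y) - f (ubar ε y) = k := fun y =>
    is_const_of_deriv_eq_zero (fun y => (hp.equation y).differentiableAt)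
      (fun y => (hp.equation y).deriv) y 0
  have := norm_deriv_le_of_nearly_const hb hbB (σ := σ)
    (by linarith [min_le_left (b / 4) (η / q)]) (u := ubar ε) (u' := deriv (ubar ε)) (u₀ := u₀)
    (e := k + f u₀) (B := fun y => B (ubar ε y))
    (fun y => (hp.differentiable y).hasDerivAt) (fun y => (h1 y).le) (fun y => (h3 y).le)
    (fun y => by
      have : B (ubar ε y) (deriv (ubar ε) y) - (k + f u₀) = f (ubar ε y) - f u₀ := by
        rw [← hconst y]; abel
      rw [this]
      exact (h2 y).le) x
  refine this.trans ?_
  have h4 : σ ≤ η / q := min_le_right _ _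
  rw [le_div_iff₀ hq0] at h4
  linarith

/-- The coefficient matrices of the linearized operator converge uniformly to those at `u₀`. -/
theorem ViscousHypotheses.eventually_coeff_mem (H : ViscousHypotheses f B U u₀)
    {ubar : ℝ → ℝ → RVec n} {um up : ℝ → RVec n} {l : Filter ℝ}
    (hprof : ∀ᶠ ε in l, IsViscousProfile f B U (ubar ε) (um ε) (up ε))
    (hunif : TendstoUniformly ubar (fun _ => u₀) l)
    {O : Set (Matrix (Fin n) (Fin n) ℂ × Matrix (Fin n) (Fin n) ℂ)}
    (hO : O ∈ 𝓝 (cMatrix (stdBasis n) (fderiv ℝ f u₀), cMatrix (stdBasis n) (B u₀))) :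
    ∀ᶠ ε in l, ∀ x, (cMatrix (stdBasis n) (viscousA f B (ubar ε) x),
      cMatrix (stdBasis n) (B (ubar ε x))) ∈ O := by
  have hU : U ∈ 𝓝 u₀ := H.isOpen.mem_nhds H.mem
  have hBc : ContinuousAt B u₀ := H.contDiff_B.continuousOn.continuousAt hU
  have hdB : ContinuousAt (fderiv ℝ B) u₀ :=
    (H.contDiff_B.continuousOn_fderiv_of_isOpen H.isOpen (by norm_num)).continuousAt hU
  have hdf : ContinuousAt (fderiv ℝ f) u₀ :=
    (H.contDiff_f.continuousOn_fderiv_of_isOpen H.isOpen (by norm_num)).continuousAt hU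
  have hcM := continuous_cMatrix (stdBasis n)
  have hfst : Tendsto (Prod.fst : RVec n × RVec n → RVec n) (𝓝 (u₀, 0)) (𝓝 u₀) :=
    continuousAt_fst
  have hA : ContinuousAt (fun p : RVec n × RVec n =>
      (cMatrix (stdBasis n) (fderiv ℝ f p.1 - (fderiv ℝ B p.1).flip p.2),
        cMatrix (stdBasis n) (B p.1))) (u₀, 0) := by
    have h1 : ContinuousAt (fun p : RVec n × RVec n => (fderiv ℝ B p.1).flip) (u₀, 0) :=
      ((ContinuousLinearMap.flipₗᵢ ℝ (RVec n) (RVec n) (RVec n)).continuous.tendsto _).comp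
        (hdB.tendsto.comp hfst)
    have h2 : ContinuousAt (fun p : RVec n × RVec n => (fderiv ℝ B p.1).flip p.2) (u₀, 0) :=
      h1.clm_apply continuousAt_snd
    have h3 : ContinuousAt (fun p : RVec n × RVec n => fderiv ℝ f p.1) (u₀, 0) :=
      hdf.tendsto.comp hfst
    have h4 : ContinuousAt (fun p : RVec n × RVec n => B p.1) (u₀, 0) := hBc.tendsto.comp hfst
    exact (ContinuousAt.comp (f := fun p : RVec n × RVec n =>
      fderiv ℝ f p.1 - (fderiv ℝ B p.1).flip p.2) hcM.continuousAt (h3.sub h2)).prodMk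
      (ContinuousAt.comp (f := fun p : RVec n × RVec n => B p.1) hcM.continuousAt h4)
  rw [ContinuousAt, nhds_prod_eq] at hA
  simp only [map_zero, sub_zero] at hA
  obtain ⟨P₁, hP₁, P₂, hP₂, hsub⟩ := eventually_prod_iff.mp (hA.eventually_mem hO)
  obtain ⟨η, hη, hball⟩ := Metric.nhds_basis_closedBall.mem_iff.mp hP₂
  filter_upwards [hunif.eventually_forall_mem hP₁, H.eventually_norm_deriv_le hprof hunif hη]
    with ε h1 h2 x
  have h3 : P₂ (deriv (ubar ε) x) := hball (mem_closedBall_zero_iff.mpr (h2 x))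
  exact hsub (h1 x) h3

/-- Left-hand matrix of the first-order pencil of the viscous eigenvalue problem, in the unknown
`(w, y)`, `y = w'/√|λ|`: with `τ = 1/√|λ|`, the pair `(w, B y - τ A w)` is differentiable. -/
def viscousPencilN (n : ℕ)
    (p : (ℂ × ℝ) × (Matrix (Fin n) (Fin n) ℂ × Matrix (Fin n) (Fin n) ℂ)) :
    Matrix (Fin n ⊕ Fin n) (Fin n ⊕ Fin n) ℂ :=
  Matrix.fromBlocks 1 0 (-((p.1.2 : ℂ) • p.2.1)) p.2.2

/-- Right-hand matrix of the first-order pencil of the viscous eigenvalue problem, where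
`ζ = λ/|λ|`. -/
def viscousPencilM (n : ℕ)
    (p : (ℂ × ℝ) × (Matrix (Fin n) (Fin n) ℂ × Matrix (Fin n) (Fin n) ℂ)) :
    Matrix (Fin n ⊕ Fin n) (Fin n ⊕ Fin n) ℂ :=
  Matrix.fromBlocks 0 1 (p.1.1 • (1 : Matrix (Fin n) (Fin n) ℂ)) 0

theorem viscousPencilN_mulVec (p : (ℂ × ℝ) × (Matrix (Fin n) (Fin n) ℂ × Matrix (Fin n) (Fin n) ℂ))
    (w y : Fin n → ℂ) : viscousPencilN n p *ᵥ Sum.elim w y =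
      Sum.elim w (p.2.2 *ᵥ y - (p.1.2 : ℂ) • p.2.1 *ᵥ w) := by
  rw [viscousPencilN, Matrix.fromBlocks_mulVec]
  simp only [Sum.elim_comp_inl, Sum.elim_comp_inr, Matrix.one_mulVec, Matrix.zero_mulVec, add_zero,
    Matrix.neg_mulVec, Matrix.smul_mulVec]
  rw [neg_add_eq_sub]

theorem viscousPencilM_mulVec (p : (ℂ × ℝ) × (Matrix (Fin n) (Fin n) ℂ × Matrix (Fin n) (Fin n) ℂ))
    (w y : Fin n → ℂ) : viscousPencilM n p *ᵥ Sum.elim w y = Sum.elim y (p.1.1 • w) := by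
  rw [viscousPencilM, Matrix.fromBlocks_mulVec]
  simp [Matrix.smul_mulVec]

/-- The viscous pencil at the constant state `u₀` has no purely imaginary mode for `ζ` on the closed
right half of the unit circle, up to and including the limit `τ = 0` of infinite frequency. -/
theorem ViscousHypotheses.pencil_hyperbolic (H : ViscousHypotheses f B U u₀) {ζ : ℂ} {τ : ℝ}
    (hζ : ‖ζ‖ = 1) (hre : 0 ≤ ζ.re) (hτ : 0 ≤ τ) (ξ : ℝ) (v : Fin n ⊕ Fin n → ℂ) (hv : v ≠ 0) :
    viscousPencilM n ((ζ, τ), cMatrix (stdBasis n) (fderiv ℝ f u₀), cMatrix (stdBasis n) (B u₀)) *ᵥ v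
      ≠ (Complex.I * ξ) • viscousPencilN n
        ((ζ, τ), cMatrix (stdBasis n) (fderiv ℝ f u₀), cMatrix (stdBasis n) (B u₀)) *ᵥ v := by
  intro heq
  set A₀ := cMatrix (stdBasis n) (fderiv ℝ f u₀)
  set B₀ := cMatrix (stdBasis n) (B u₀)
  obtain ⟨w, y, rfl⟩ : ∃ w y, v = Sum.elim w y :=
    ⟨v ∘ Sum.inl, v ∘ Sum.inr, (Sum.elim_comp_inl_inr v).symm⟩
  rw [viscousPencilM_mulVec, viscousPencilN_mulVec] at heq
  have hy : y = (Complex.I * ξ) • w := by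
    funext i; simpa using congrFun heq (Sum.inl i)
  have hw : ζ • w = (Complex.I * ξ) • (B₀ *ᵥ y - (τ : ℂ) • A₀ *ᵥ w) := by
    funext i; simpa using congrFun heq (Sum.inr i)
  have hζ0 : ζ ≠ 0 := by rintro rfl; simp at hζ
  have hw0 : w ≠ 0 := by
    rintro rfl
    refine hv ?_
    rw [hy, smul_zero]
    funext i; rcases i with i | i <;> rfl
  have hξ : ξ ≠ 0 := by
    rintro rfl
    simp [hζ0, hw0] at hw
  rw [hy, Matrix.mulVec_smul] at hw
  have hI : (Complex.I * (ξ : ℂ)) * (Complex.I * ξ) = -(ξ : ℂ) ^ 2 := by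
    rw [mul_mul_mul_comm, Complex.I_mul_I]; ring
  rcases hτ.eq_or_lt with rfl | hτ
  · -- the limit `λ → ∞` only sees the viscosity
    have h1 : B₀ *ᵥ w = (-(ζ / (ξ : ℂ) ^ 2)) • w := by
      have hξ2 : (ξ : ℂ) ^ 2 ≠ 0 := by simpa using hξ
      have h2 : ζ • w = (-(ξ : ℂ) ^ 2) • B₀ *ᵥ w := by
        rw [hw]; simp [smul_smul, hI]
      rw [← neg_div, div_eq_inv_mul, ← smul_smul, neg_smul, h2, smul_neg, smul_smul]
      simp [inv_mul_cancel₀ hξ2]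
    have h3 := H.parabolic _ ((mem_spectrum_iff_exists_mulVec _ _).mpr ⟨w, hw0, h1⟩)
    have h4 : (ζ / (ξ : ℂ) ^ 2).re = ζ.re / ξ ^ 2 := by
      rw [← Complex.ofReal_pow, Complex.div_ofReal_re]
    rw [Complex.neg_re, h4] at h3
    have : 0 ≤ ζ.re / ξ ^ 2 := by positivity
    linarith
  · -- for `τ > 0` a mode with wave number `ξ` is an eigenvalue `ζ/τ²` of the symbol at `ξ/τ`
    obtain ⟨θ, hθ, hst⟩ := H.stable
    have hτ' : (τ : ℂ) ≠ 0 := by exact_mod_cast hτ.ne'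
    have h1 : (-(Complex.I * ((ξ / τ : ℝ) : ℂ)) • A₀ - (((ξ / τ : ℝ) : ℂ) ^ 2) • B₀) *ᵥ w =
        (ζ / ((τ ^ 2 : ℝ) : ℂ)) • w := by
      rw [div_eq_inv_mul ζ, ← smul_smul, hw, Matrix.sub_mulVec, Matrix.smul_mulVec,
        Matrix.smul_mulVec, smul_sub, smul_sub, smul_smul, smul_smul, smul_smul, smul_smul,
        mul_assoc _ (Complex.I * (ξ : ℂ)) (Complex.I * ξ), hI]
      rw [sub_eq_neg_add, ← neg_smul, sub_eq_add_neg, ← neg_smul]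
      congr 2
      · push_cast; field_simp
      · push_cast; field_simp
    have h2 := hst (ξ / τ) _ ((mem_spectrum_iff_exists_mulVec _ _).mpr ⟨w, hw0, h1⟩)
    rw [Complex.div_ofReal_re] at h2
    have h3 : 0 ≤ ζ.re / τ ^ 2 := by positivity
    have h4 : 0 < θ * (ξ / τ) ^ 2 := by positivity
    linarith

theorem norm_sum_elim_sq_le {ι κ : Type*} [Fintype ι] [Fintype κ] (w : ι → ℂ) (y : κ → ℂ) :
    ‖Sum.elim w y‖ ^ 2 ≤ ‖w‖ ^ 2 + ‖y‖ ^ 2 := by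
  have h1 : ‖Sum.elim w y‖ ≤ max ‖w‖ ‖y‖ := by
    refine (pi_norm_le_iff_of_nonneg (by positivity)).mpr ?_
    rintro (i | i)
    · exact (norm_le_pi_norm w i).trans (le_max_left _ _)
    · exact (norm_le_pi_norm y i).trans (le_max_right _ _)
  calc ‖Sum.elim w y‖ ^ 2 ≤ max ‖w‖ ‖y‖ ^ 2 := by gcongr
    _ ≤ _ := by
        rcases max_cases ‖w‖ ‖y‖ with h | h <;> rw [h.1] <;>
          nlinarith [sq_nonneg ‖w‖, sq_nonneg ‖y‖]

/-- For profiles uniformly close to `u₀`, no unstable eigenvalue has modulus above `δ`. After the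
rescaling `ζ = λ/|λ|`, `τ = 1/√|λ|`, the set of parameters with `|λ| ≥ δ` is relatively compact, so
that the symmetrizers of the constant-coefficient problem tolerate a perturbation of the coefficients
that is uniform in `λ`. -/
theorem ViscousHypotheses.eventually_norm_eigenvalue_le (H : ViscousHypotheses f B U u₀)
    {ubar : ℝ → ℝ → RVec n} {um up : ℝ → RVec n} {l : Filter ℝ}
    (hprof : ∀ᶠ ε in l, IsViscousProfile f B U (ubar ε) (um ε) (up ε))
    (hunif : TendstoUniformly ubar (fun _ => u₀) l) {δ : ℝ} (hδ : 0 < δ) :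
    ∀ᶠ ε in l, ∀ lam : ℂ, 0 ≤ lam.re → IsViscousEigenvalue f B (ubar ε) lam → ‖lam‖ ≤ δ := by
  have hK : IsCompact ({ζ : ℂ | ‖ζ‖ = 1 ∧ 0 ≤ ζ.re} ×ˢ Icc (0 : ℝ) (1 / √δ)) := by
    refine IsCompact.prod ?_ isCompact_Icc
    refine (isCompact_sphere (0 : ℂ) 1).of_isClosed_subset ?_ fun ζ hζ => by simpa using hζ.1
    exact (isClosed_eq continuous_norm continuous_const).inter
      (isClosed_le continuous_const Complex.continuous_re)
  obtain ⟨O, hO, hsym⟩ := exists_uniform_pencil_symmetrizer hK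
    (cMatrix (stdBasis n) (fderiv ℝ f u₀), cMatrix (stdBasis n) (B u₀))
    (viscousPencilN n) (viscousPencilM n)
    (by unfold viscousPencilN; fun_prop) (by unfold viscousPencilM; fun_prop)
    (fun k hk => by
      rw [viscousPencilN, Matrix.det_fromBlocks_zero₁₂, Matrix.det_one, one_mul,
        ← Matrix.isUnit_iff_isUnit_det, ← spectrum.zero_notMem_iff ℂ]
      exact fun h => by simpa using H.parabolic 0 h)
    (fun k hk => H.pencil_hyperbolic hk.1.1 hk.1.2 hk.2.1)
  filter_upwards [H.eventually_coeff_mem hprof hunif hO] with ε hε lam hre ⟨w, hw0, hw2, hwd, hode⟩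
  by_contra! hlam
  refine hw0 ?_
  have hl0 : 0 < ‖lam‖ := hδ.trans hlam
  set ρ := √‖lam‖
  have hρ0 : 0 < ρ := Real.sqrt_pos.mpr hl0
  have hρ2 : ρ * ρ = ‖lam‖ := Real.mul_self_sqrt hl0.le
  have hρC : (ρ : ℂ) ≠ 0 := by exact_mod_cast hρ0.ne'
  set ζ : ℂ := lam / ‖lam‖ with hζ
  have hζl : ζ = lam / ((ρ : ℂ) * ρ) := by rw [hζ, ← hρ2]; push_cast; rfl
  have hk : (ζ, ρ⁻¹) ∈ {ζ : ℂ | ‖ζ‖ = 1 ∧ 0 ≤ ζ.re} ×ˢ Icc (0 : ℝ) (1 / √δ) := by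
    refine ⟨⟨?_, ?_⟩, by positivity, ?_⟩
    · rw [hζ, norm_div]; simp [hl0.ne']
    · rw [hζ, Complex.div_ofReal_re]; positivity
    · rw [one_div]
      have : 0 < √δ := Real.sqrt_pos.mpr hδ
      exact inv_anti₀ this (Real.sqrt_le_sqrt hlam.le)
  obtain ⟨S, hS, c, hc, D, hSO⟩ := hsym _ hk
  set e : ℝ → Matrix (Fin n) (Fin n) ℂ × Matrix (Fin n) (Fin n) ℂ := fun x =>
    (cMatrix (stdBasis n) (viscousA f B (ubar ε) x), cMatrix (stdBasis n) (B (ubar ε x))) with he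
  set φ : ℝ → Fin n → ℂ := fun y => cMatrix (stdBasis n) (B (ubar ε y)) *ᵥ deriv w y
        - cMatrix (stdBasis n) (viscousA f B (ubar ε) y) *ᵥ w y with hφ
  set v : ℝ → Fin n ⊕ Fin n → ℂ := fun x => Sum.elim (w x) (((ρ⁻¹ : ℝ) : ℂ) • deriv w x) with hv
  -- only `w` is assumed to be in `L²`; the flux `φ`, being a primitive of `λ w`, grows linearly,
  -- which already rules out exponential growth of the energy
  obtain ⟨C, hC0, hC⟩ := exists_linear_growth hwd.continuous hw2 hode
  have hNv : ∀ x, viscousPencilN n ((ζ, ρ⁻¹), e x) *ᵥ v x =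
      Sum.elim (w x) (((ρ⁻¹ : ℝ) : ℂ) • φ x) := fun x => by
    rw [hv, viscousPencilN_mulVec, hφ, smul_sub, Matrix.mulVec_smul]
  have hvz : v = 0 := by
    refine eq_zero_of_pencil hS (N := fun x => viscousPencilN n ((ζ, ρ⁻¹), e x))
      (M := fun x => viscousPencilM n ((ζ, ρ⁻¹), e x)) (ρ := ρ) (C := (ρ⁻¹ * C) ^ 2) hc hρ0
      (fun x => (hSO _ (hε x) _).1) (fun x => (hSO _ (hε x) _).2)
      (hw2.integrable_norm_pow two_ne_zero) (fun x => ?_) (fun x => ?_)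
    · rw [hNv]
      refine (norm_sum_elim_sq_le _ _).trans ?_
      rw [norm_smul, Complex.norm_real, Real.norm_of_nonneg (by positivity), ← mul_pow, mul_assoc]
      gcongr
      exact hC x
    · simp only [hNv]
      rw [hv, viscousPencilM_mulVec, hasDerivAt_pi]
      rintro (i | i)
      · have := hasDerivAt_pi.mp (hwd x).hasDerivAt i
        refine this.congr_deriv ?_
        simp [hρC]
      · have := (hasDerivAt_pi.mp (hode x) i).const_mul ((ρ⁻¹ : ℝ) : ℂ)
        refine this.congr_deriv ?_
        simp [hζl]
        field_simp
  funext x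
  have := congrFun hvz x
  funext i
  simpa [hv] using congrFun this (Sum.inl i)

end Viscous

/-! ### Kernels of constant dimension -/

/-- Where the kernels of a `C¹` family of linear maps have constant dimension, every element of the
kernel at the base point extends to a `C¹` section of the kernels. -/
theorem exists_contDiffAt_ker_section {P E F : Type*} [NormedAddCommGroup P] [NormedSpace ℝ P]
    [NormedAddCommGroup E] [NormedSpace ℝ E] [FiniteDimensional ℝ E]
    [NormedAddCommGroup F] [NormedSpace ℝ F] [FiniteDimensional ℝ F]
    {L : P → E →L[ℝ] F} {p₀ : P} (hL : ContDiffAt ℝ 1 L p₀)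
    (hrank : ∀ᶠ p in 𝓝 p₀, Module.finrank ℝ (L p : E →ₗ[ℝ] F).ker =
      Module.finrank ℝ (L p₀ : E →ₗ[ℝ] F).ker) {s₀ : E} (hs₀ : L p₀ s₀ = 0) :
    ∃ s : P → E, ContDiffAt ℝ 1 s p₀ ∧ s p₀ = s₀ ∧ ∀ᶠ p in 𝓝 p₀, L p (s p) = 0 := by
  have : CompleteSpace E := FiniteDimensional.complete ℝ E
  set K := (L p₀ : E →ₗ[ℝ] F).ker with hK
  obtain ⟨C, hC⟩ := K.exists_isCompl
  obtain ⟨R₀, hR₀⟩ := ((L p₀ : E →ₗ[ℝ] F).domRestrict C).exists_leftInverse_of_injective (by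
    rw [LinearMap.ker_eq_bot']
    intro x hx
    have h1 : (x : E) ∈ K := by simpa [hK] using hx
    exact Subtype.ext (Submodule.disjoint_def.mp hC.disjoint x h1 x.2))
  let R : F →L[ℝ] E := LinearMap.toContinuousLinearMap (C.subtype.comp R₀)
  let π : E →L[ℝ] E := LinearMap.toContinuousLinearMap (K.projection C hC)
  have hRC : ∀ y, R y ∈ C := fun y => (R₀ y).2
  have hRL : ∀ x ∈ C, R (L p₀ x) = x := fun x hx => by
    have := LinearMap.congr_fun hR₀ ⟨x, hx⟩
    exact congrArg Subtype.val this
  have hπK : ∀ x, π x ∈ K := fun x => Submodule.projection_apply_mem hC x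
  have hπc : ∀ x, x - π x ∈ C := fun x => Submodule.sub_projection_mem hC x
  -- `Φ p` is invertible near `p₀` and maps `ker (R ∘ L p)` into `ker (L p₀)`
  let Φ : P → E →L[ℝ] E := fun p => R.comp (L p) + π
  have hΦ : ContDiffAt ℝ 1 Φ p₀ := (contDiffAt_const.clm_comp hL).add contDiffAt_const
  have hΦ₀ : Φ p₀ = 1 := by
    ext x
    have h1 : L p₀ x = L p₀ (x - π x) := by
      rw [map_sub, show L p₀ (π x) = 0 from hπK x, sub_zero]
    change R (L p₀ x) + π x = x
    rw [h1, hRL _ (hπc x)]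
    abel
  have hunit : ∀ᶠ p in 𝓝 p₀, IsUnit (Φ p) :=
    hΦ.continuousAt.eventually_mem (Units.isOpen.mem_nhds (by
      rw [mem_ofPred_eq, hΦ₀]; exact isUnit_one))
  refine ⟨fun p => Ring.inverse (Φ p) s₀, ?_, ?_, ?_⟩
  · have h1 : ContDiffAt ℝ 1 (fun p => Ring.inverse (Φ p)) p₀ := by
      have h2 := contDiffAt_ringInverse ℝ (n := 1) (1 : (E →L[ℝ] E)ˣ)
      rw [Units.val_one, ← hΦ₀] at h2
      exact h2.comp p₀ hΦ
    exact h1.clm_apply contDiffAt_const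
  · simp only [hΦ₀, Ring.inverse_one]; rfl
  · filter_upwards [hunit, hrank] with p hp hr
    set s := Ring.inverse (Φ p) s₀
    have hΦs : R (L p s) + π s = s₀ := by
      have : (Φ p * Ring.inverse (Φ p)) s₀ = s₀ := by rw [Ring.mul_inverse_cancel _ hp]; rfl
      exact this
    have hker : ∀ x, R (L p x) + π x ∈ K → R (L p x) = 0 := fun x hx =>
      Submodule.disjoint_def.mp hC.disjoint _ (by
        have := K.sub_mem hx (hπK x)
        rwa [add_sub_cancel_right] at this) (hRC _)
    have hinj : Function.Injective (Φ p) := by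
      rw [injective_iff_map_eq_zero]
      intro x hx
      have : (Ring.inverse (Φ p) * Φ p) x = x := by rw [Ring.inverse_mul_cancel _ hp]; rfl
      rw [← this]
      change Ring.inverse (Φ p) (Φ p x) = 0
      rw [hx, map_zero]
    have hle : (L p : E →ₗ[ℝ] F).ker ≤ (R.comp (L p) : E →ₗ[ℝ] E).ker := fun x hx => by
      have : L p x = 0 := hx
      change R (L p x) = 0
      rw [this, map_zero]
    have heq : (L p : E →ₗ[ℝ] F).ker = (R.comp (L p) : E →ₗ[ℝ] E).ker := by
      refine Submodule.eq_of_le_of_finrank_le hle ?_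
      rw [hr]
      let g : (R.comp (L p) : E →ₗ[ℝ] E).ker →ₗ[ℝ] K :=
        ((Φ p : E →ₗ[ℝ] E).domRestrict _).codRestrict K (fun x => by
          have h1 : R (L p x) = 0 := x.2
          change R (L p x) + π x ∈ K
          rw [h1, zero_add]
          exact hπK _)
      refine LinearMap.finrank_le_finrank_of_injective (f := g) fun x y hxy => ?_
      exact Subtype.ext (hinj (congrArg Subtype.val hxy))
    have hmem : s ∈ (R.comp (L p) : E →ₗ[ℝ] E).ker := hker s (by rw [hΦs]; exact hs₀)
    rw [← heq] at hmem
    exact hmem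

/-! ### Diagonalization with constant multiplicities -/

/-- A real operator whose eigenspaces fill the space is diagonal in a suitable basis, with a
pattern of equal diagonal entries that only depends on the multiplicities. -/
theorem exists_diagonalization {V ι : Type*} [NormedAddCommGroup V] [NormedSpace ℝ V]
    [FiniteDimensional ℝ V] [Fintype ι] [DecidableEq ι] (b : Module.Basis ι ℝ V) {k : ℕ}
    {d : Fin k → ℕ} (hd : ∑ j, d j = Module.finrank ℝ V) : ∃ blk : ι → Fin k,
      ∀ (A : V →L[ℝ] V) (a : Fin k → ℝ), Function.Injective a →
        (∀ j, Module.finrank ℝ (Module.End.eigenspace (A : V →ₗ[ℝ] V) (a j)) = d j) →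
        ∃ T : Matrix ι ι ℂ, IsUnit T.det ∧
          cMatrix b A * T = T * Matrix.diagonal fun i => ((a (blk i) : ℝ) : ℂ) := by
  have hcard : Fintype.card (Σ j, Fin (d j)) = Fintype.card ι := by
    rw [Fintype.card_sigma]
    simp only [Fintype.card_fin]
    rw [hd, Module.finrank_eq_card_basis b]
  obtain ⟨e⟩ := Fintype.truncEquivOfCardEq hcard
  refine ⟨fun i => (e.symm i).1, fun A a ha hA => ?_⟩
  let vj : ∀ j, Module.Basis (Fin (d j)) ℝ (Module.End.eigenspace (A : V →ₗ[ℝ] V) (a j)) :=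
    fun j => Module.finBasisOfFinrankEq ℝ _ (hA j)
  have hindep : iSupIndep fun j => Module.End.eigenspace (A : V →ₗ[ℝ] V) (a j) :=
    (Module.End.eigenspaces_iSupIndep (A : V →ₗ[ℝ] V)).comp ha
  have hspan : ∀ j, Submodule.span ℝ (range fun i => ((vj j i : _) : V)) ≤
      Module.End.eigenspace (A : V →ₗ[ℝ] V) (a j) := fun j =>
    Submodule.span_le.mpr (by rintro _ ⟨i, rfl⟩; exact (vj j i).2)
  have hlin : LinearIndependent ℝ fun s : Σ j, Fin (d j) => ((vj s.1 s.2 : _) : V) := by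
    refine linearIndependent_iUnion_finite
      (f := fun j i => ((vj j i : _) : V)) (fun j => ?_) (fun j t _ hj => ?_)
    · exact (vj j).linearIndependent.map' (Submodule.subtype _) (Submodule.ker_subtype _)
    · exact (hindep.disjoint_biSup hj).mono (hspan j) (iSup₂_mono fun i _ => hspan i)
  let v : Module.Basis ι ℝ V := (basisOfLinearIndependentOfCardEqFinrank' _ hlin (by
    rw [hcard, Module.finrank_eq_card_basis b])).reindex e
  have hv : ∀ i, v i = ((vj (e.symm i).1 (e.symm i).2 : _) : V) := fun i => by simp [v]
  have hAv : ∀ i, A (v i) = a (e.symm i).1 • v i := fun i => by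
    rw [hv]
    exact Module.End.mem_eigenspace_iff.mp (vj (e.symm i).1 (e.symm i).2).2
  refine ⟨(b.toMatrix v).map (fun x : ℝ => (x : ℂ)), ?_, ?_⟩
  · have h1 : IsUnit (b.toMatrix v).det := by
      rw [← Matrix.isUnit_iff_isUnit_det]
      have := b.invertibleToMatrix v
      exact isUnit_of_invertible _
    have h2 : ((b.toMatrix v).map (fun x : ℝ => (x : ℂ))).det =
        Complex.ofRealHom (b.toMatrix v).det :=
      (RingHom.map_det Complex.ofRealHom _).symm
    rw [h2]
    exact h1.map _
  · ext i j
    have h1 := congrFun (cMatrix_mulVec_repr b A (v j)) i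
    rw [Matrix.mul_diagonal, Matrix.mul_apply]
    simp only [Matrix.map_apply, Module.Basis.toMatrix_apply]
    rw [hAv, map_smul] at h1
    simp only [Matrix.mulVec, dotProduct, Finsupp.smul_apply, smul_eq_mul, Complex.ofReal_mul] at h1
    rw [h1, mul_comm]

/-! ### Symmetrizers of matrices with constant multiplicities -/

section Symmetrizer

variable {ι : Type} [Fintype ι] [DecidableEq ι]

/-- The defect `X A - Aᴴ X` of `X` as a symmetrizer of `A`; it is only real linear in `A`, and is
taken real linear in `X` as well, so that the dimension count is over `ℝ` throughout. -/
def symmetrizerDefect (A : Matrix ι ι ℂ) : Matrix ι ι ℂ →ₗ[ℝ] Matrix ι ι ℂ where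
  toFun X := X * A - Aᴴ * X
  map_add' X Y := by rw [Matrix.add_mul, Matrix.mul_add]; abel
  map_smul' c X := by simp [smul_sub]

/-- The matrices that are block diagonal with respect to a labelling `blk` of the indices. -/
def blockDiagonalSubmodule {κ : Type*} (blk : ι → κ) : Submodule ℝ (Matrix ι ι ℂ) where
  carrier := {Z | ∀ i j, blk i ≠ blk j → Z i j = 0}
  add_mem' h1 h2 i j h := by simp [h1 i j h, h2 i j h]
  zero_mem' i j _ := rfl
  smul_mem' c Z h1 i j h := by simp [h1 i j h]

/-- The symmetrizers of a diagonalizable matrix with real eigenvalues form a space whose dimension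
depends only on the multiplicities: congruence by the diagonalizing matrix `T` turns them into the
block diagonal matrices. -/
theorem finrank_ker_symmetrizerDefect {κ : Type*} (blk : ι → κ) (A T : Matrix ι ι ℂ) (a : κ → ℝ)
    (ha : Function.Injective a) (hT : IsUnit T.det)
    (hAT : A * T = T * Matrix.diagonal fun i => ((a (blk i) : ℝ) : ℂ)) :
    Module.finrank ℝ (symmetrizerDefect A).ker =
      Module.finrank ℝ (blockDiagonalSubmodule blk) := by
  set D := Matrix.diagonal fun i => ((a (blk i) : ℝ) : ℂ) with hD
  have hDH : Dᴴ = D := by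
    rw [hD, Matrix.diagonal_conjTranspose]
    congr 1
    funext i
    simp
  have hTT : T * T⁻¹ = 1 := Matrix.mul_nonsing_inv _ hT
  have hTT' : T⁻¹ * T = 1 := Matrix.nonsing_inv_mul _ hT
  have hTH : Tᴴ * T⁻¹ᴴ = 1 := by rw [← Matrix.conjTranspose_mul, hTT', Matrix.conjTranspose_one]
  have hTH' : T⁻¹ᴴ * Tᴴ = 1 := by rw [← Matrix.conjTranspose_mul, hTT, Matrix.conjTranspose_one]
  let e : Matrix ι ι ℂ ≃ₗ[ℝ] Matrix ι ι ℂ :=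
    { toFun := fun X => Tᴴ * X * T
      invFun := fun X => T⁻¹ᴴ * X * T⁻¹
      map_add' := fun X Y => by rw [Matrix.mul_add, Matrix.add_mul]
      map_smul' := fun c X => by simp
      left_inv := fun X => by
        calc T⁻¹ᴴ * (Tᴴ * X * T) * T⁻¹ = (T⁻¹ᴴ * Tᴴ) * X * (T * T⁻¹) := by
              simp only [Matrix.mul_assoc]
          _ = X := by rw [hTH', hTT, Matrix.one_mul, Matrix.mul_one]
      right_inv := fun X => by
        calc Tᴴ * (T⁻¹ᴴ * X * T⁻¹) * T = (Tᴴ * T⁻¹ᴴ) * X * (T⁻¹ * T) := by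
              simp only [Matrix.mul_assoc]
          _ = X := by rw [hTH, hTT', Matrix.one_mul, Matrix.mul_one] }
  rw [← LinearEquiv.finrank_map_eq e]
  have key : ∀ X, X ∈ (symmetrizerDefect A).ker ↔ ∀ i j, blk i ≠ blk j → (e X) i j = 0 := by
    intro X
    have h1 : e (symmetrizerDefect A X) = e X * D - D * e X := by
      change Tᴴ * (X * A - Aᴴ * X) * T = Tᴴ * X * T * D - D * (Tᴴ * X * T)
      have h2 : Tᴴ * Aᴴ = D * Tᴴ := by
        rw [← Matrix.conjTranspose_mul, hAT, Matrix.conjTranspose_mul, hDH]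
      rw [Matrix.mul_sub, Matrix.sub_mul]
      congr 1
      · rw [Matrix.mul_assoc, Matrix.mul_assoc X, hAT]; simp only [Matrix.mul_assoc]
      · rw [← Matrix.mul_assoc Tᴴ, h2]; simp only [Matrix.mul_assoc]
    rw [LinearMap.mem_ker, ← e.map_eq_zero_iff, h1, ← Matrix.ext_iff]
    refine forall_congr' fun i => forall_congr' fun j => ?_
    rw [Matrix.sub_apply, hD, Matrix.mul_diagonal, Matrix.diagonal_mul, Matrix.zero_apply,
      mul_comm, ← sub_mul, mul_eq_zero, sub_eq_zero, Complex.ofReal_inj, ha.eq_iff]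
    constructor
    · rintro (h | h) hij
      exacts [absurd h.symm hij, h]
    · intro h
      by_cases hij : blk i = blk j
      exacts [Or.inl hij.symm, Or.inr (h hij)]
  refine congrArg (fun W : Submodule ℝ (Matrix ι ι ℂ) => Module.finrank ℝ W) ?_
  ext Z
  constructor
  · rintro ⟨X, hX, rfl⟩
    exact (key X).mp hX
  · intro hZ
    exact ⟨e.symm Z, (key _).mpr (by rw [e.apply_symm_apply]; exact hZ), e.apply_symm_apply Z⟩

/-- A `C¹` family of matrices with real semisimple spectrum of constant multiplicities has a `C¹`
family of symmetrizers with any prescribed value at the base point. The symmetrizer condition is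
linear with a kernel of constant dimension; no differentiability of the eigenvectors is needed. -/
theorem exists_contDiffAt_symmetrizer {P κ : Type*} [NormedAddCommGroup P] [NormedSpace ℝ P]
    {A : P → Matrix ι ι ℂ} {p₀ : P} (hA : ∀ i j, ContDiffAt ℝ 1 (fun p => A p i j) p₀)
    (blk : ι → κ)
    (hdiag : ∀ᶠ p in 𝓝 p₀, ∃ (T : Matrix ι ι ℂ) (a : κ → ℝ), Function.Injective a ∧
      IsUnit T.det ∧ A p * T = T * Matrix.diagonal fun i => ((a (blk i) : ℝ) : ℂ))
    {S₀ : Matrix ι ι ℂ} (hS₀ : S₀.IsHermitian) (hSA : S₀ * A p₀ = (A p₀)ᴴ * S₀) :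
    ∃ S : P → Matrix ι ι ℂ, (∀ i j, ContDiffAt ℝ 1 (fun p => S p i j) p₀) ∧ S p₀ = S₀ ∧
      (∀ p, (S p).IsHermitian) ∧ ∀ᶠ p in 𝓝 p₀, S p * A p = (A p)ᴴ * S p := by
  -- the space of matrices, with the norm of `ι → ι → ℂ`
  let o : (ι → ι → ℂ) ≃ₗ[ℝ] Matrix ι ι ℂ := Matrix.ofLinearEquiv ℝ
  let Λ₀ : (ι → ι → ℂ) →ₗ[ℝ] ((ι → ι → ℂ) →L[ℝ] (ι → ι → ℂ)) :=
    { toFun := fun A => LinearMap.toContinuousLinearMap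
        (o.symm.toLinearMap ∘ₗ symmetrizerDefect (o A) ∘ₗ o.toLinearMap)
      map_add' := fun A A' => by
        ext1 X
        change o X * (o A + o A') - (o A + o A')ᴴ * o X =
          (o X * o A - (o A)ᴴ * o X) + (o X * o A' - (o A')ᴴ * o X)
        rw [Matrix.conjTranspose_add, Matrix.mul_add, Matrix.add_mul]; abel
      map_smul' := fun c A => by
        ext1 X
        change o X * (c • o A) - (c • o A)ᴴ * o X = c • (o X * o A - (o A)ᴴ * o X)
        simp [smul_sub, Matrix.conjTranspose_smul] }
  let Λ : (ι → ι → ℂ) →L[ℝ] ((ι → ι → ℂ) →L[ℝ] (ι → ι → ℂ)) := LinearMap.toContinuousLinearMap Λ₀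
  have hΛ : ∀ A X, Λ A X = o.symm (o X * o A - (o A)ᴴ * o X) := fun A X => rfl
  have hA' : ContDiffAt ℝ 1 (fun p => o.symm (A p)) p₀ :=
    contDiffAt_pi.mpr fun i => contDiffAt_pi.mpr fun j => hA i j
  have hL : ContDiffAt ℝ 1 (fun p => Λ (o.symm (A p))) p₀ := Λ.contDiff.contDiffAt.comp p₀ hA'
  have hker : ∀ A : Matrix ι ι ℂ,
      Module.finrank ℝ (Λ (o.symm A) : (ι → ι → ℂ) →ₗ[ℝ] (ι → ι → ℂ)).ker =
        Module.finrank ℝ (symmetrizerDefect A).ker := fun A => by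
    rw [← LinearEquiv.finrank_map_eq o]
    refine congrArg (fun W : Submodule ℝ (Matrix ι ι ℂ) => Module.finrank ℝ W) ?_
    ext X
    constructor
    · rintro ⟨Y, hY, rfl⟩
      exact o.symm.map_eq_zero_iff.mp hY
    · intro hX
      exact ⟨o.symm X, o.symm.map_eq_zero_iff.mpr hX, rfl⟩
  obtain ⟨s, hs, hs0, hsA⟩ := exists_contDiffAt_ker_section hL (s₀ := o.symm S₀) (by
      filter_upwards [hdiag] with p hp
      obtain ⟨T, a, ha, hT, hAT⟩ := hp
      obtain ⟨T', a', ha', hT', hAT'⟩ := hdiag.self_of_nhds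
      rw [hker, hker]
      exact (finrank_ker_symmetrizerDefect blk _ T a ha hT hAT).trans
        (finrank_ker_symmetrizerDefect blk _ T' a' ha' hT' hAT').symm)
    (by
      rw [hΛ]
      exact o.symm.map_eq_zero_iff.mpr (sub_eq_zero.mpr hSA))
  have hsij : ∀ i j, ContDiffAt ℝ 1 (fun p => s p i j) p₀ := fun i j =>
    contDiffAt_pi.mp (contDiffAt_pi.mp hs i) j
  refine ⟨fun p => (1 / 2 : ℝ) • (o (s p) + (o (s p))ᴴ), fun i j => ?_, ?_, fun p => ?_, ?_⟩
  · have h1 : ContDiffAt ℝ 1 (fun p => Complex.conjCLE (s p j i)) p₀ :=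
      Complex.conjCLE.contDiff.contDiffAt.comp p₀ (hsij j i)
    exact (contDiffAt_const (c := (1 / 2 : ℝ))).smul ((hsij i j).add h1)
  · have : o (s p₀) = S₀ := by rw [hs0]; rfl
    simp only [this]
    rw [hS₀.eq, ← two_smul ℝ, smul_smul]; norm_num
  · rw [Matrix.IsHermitian, Matrix.conjTranspose_smul, Matrix.conjTranspose_add,
      Matrix.conjTranspose_conjTranspose, add_comm, star_trivial]
  · filter_upwards [hsA] with p hp
    have hp1 : o (s p) * A p = (A p)ᴴ * o (s p) := sub_eq_zero.mp (o.symm.map_eq_zero_iff.mp hp)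
    have hp2 : (o (s p))ᴴ * A p = (A p)ᴴ * (o (s p))ᴴ := by
      have := congrArg Matrix.conjTranspose hp1
      rw [Matrix.conjTranspose_mul, Matrix.conjTranspose_mul,
        Matrix.conjTranspose_conjTranspose] at this
      exact this.symm
    rw [Matrix.smul_mul, Matrix.mul_smul, Matrix.add_mul, Matrix.mul_add, hp1, hp2]

end Symmetrizer

/-! ### The compensating matrix of a stable hyperbolic system with relaxation -/

section Compensator

variable {ι : Type}

/-- The part of `M` that is block diagonal with respect to the level sets of `a`. -/
noncomputable def blockPart (a : ι → ℝ) (M : Matrix ι ι ℂ) : Matrix ι ι ℂ :=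
  Matrix.of fun i j => if a i = a j then M i j else 0

theorem blockPart_apply (a : ι → ℝ) (M : Matrix ι ι ℂ) (i j : ι) :
    blockPart a M i j = if a i = a j then M i j else 0 := rfl

theorem blockPart_conjTranspose (a : ι → ℝ) (M : Matrix ι ι ℂ) :
    (blockPart a M)ᴴ = blockPart a Mᴴ := by
  ext i j
  simp only [Matrix.conjTranspose_apply, blockPart_apply, eq_comm (a := a i)]
  split_ifs <;> simp

variable [Fintype ι]

theorem blockPart_mul (a : ι → ℝ) (M N : Matrix ι ι ℂ) :
    blockPart a M * blockPart a N = blockPart a (M * blockPart a N) := by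
  ext i j
  simp only [Matrix.mul_apply, blockPart_apply]
  split_ifs with h
  · refine Finset.sum_congr rfl fun k _ => ?_
    by_cases hk : a k = a j
    · simp [hk, h]
    · simp [hk]
  · refine Finset.sum_eq_zero fun k _ => ?_
    by_cases hk : a i = a k
    · rw [if_neg (show ¬ a k = a j from fun h' => h (hk.trans h')), mul_zero]
    · rw [if_neg hk, zero_mul]

theorem blockPart_mul_right (a : ι → ℝ) (M N : Matrix ι ι ℂ) :
    blockPart a (blockPart a M * N) = blockPart a M * blockPart a N := by
  ext i j
  simp only [Matrix.mul_apply, blockPart_apply]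
  split_ifs with h
  · refine Finset.sum_congr rfl fun k _ => ?_
    by_cases hk : a i = a k
    · simp [hk.symm.trans h]
    · simp [hk]
  · refine (Finset.sum_eq_zero fun k _ => ?_).symm
    by_cases hk : a i = a k
    · rw [if_neg (show ¬ a k = a j from fun h' => h (hk.trans h')), mul_zero]
    · rw [if_neg hk, zero_mul]

theorem Accretive.blockPart {M : Matrix ι ι ℂ} (hM : Accretive M) (a : ι → ℝ) :
    Accretive (blockPart a M) := by
  classical
  intro v hv
  have hform : (star v ⬝ᵥ _root_.blockPart a M *ᵥ v) = ∑ c ∈ Finset.univ.image a,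
      (star (fun i => if a i = c then v i else 0 : ι → ℂ) ⬝ᵥ
        M *ᵥ (fun i => if a i = c then v i else 0)) := by
    simp only [dotProduct, Matrix.mulVec, Finset.mul_sum, blockPart_apply, Pi.star_apply]
    conv_rhs => rw [Finset.sum_comm]
    refine Finset.sum_congr rfl fun i _ => ?_
    conv_rhs => rw [Finset.sum_comm]
    refine Finset.sum_congr rfl fun j _ => ?_
    rw [Finset.sum_eq_single (a i)]
    · by_cases h : a i = a j
      · simp [h]
      · simp [h, Ne.symm h]
    · intro c _ hc
      simp [Ne.symm hc]
    · intro h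
      exact absurd (Finset.mem_image_of_mem a (Finset.mem_univ i)) h
  rw [hform, Complex.re_sum]
  obtain ⟨i, hi⟩ := Function.ne_iff.mp hv
  refine Finset.sum_pos' (fun c _ => ?_) ⟨a i, Finset.mem_image_of_mem a (Finset.mem_univ i), ?_⟩
  · by_cases h0 : (fun i => if a i = c then v i else 0) = 0
    · simp [h0]
    · exact (hM _ h0).le
  · exact hM _ (Function.ne_iff.mpr ⟨i, by simpa using hi⟩)

theorem re_star_dotProduct_conjTranspose (M : Matrix ι ι ℂ) (v : ι → ℂ) :
    (star v ⬝ᵥ Mᴴ *ᵥ v).re = (star v ⬝ᵥ M *ᵥ v).re := by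
  rw [Matrix.dotProduct_mulVec, ← Matrix.star_mulVec, Matrix.star_dotProduct,
    Complex.star_def, Complex.conj_re]

theorem blockPart_mulVec_restrict (a : ι → ℝ) (Q : Matrix ι ι ℂ) (v : ι → ℂ) (c : ℝ) :
    blockPart a Q *ᵥ (fun i => if a i = c then v i else 0) =
      fun i => if a i = c then (blockPart a Q *ᵥ v) i else 0 := by
  funext i
  simp only [Matrix.mulVec, dotProduct, blockPart_apply]
  split_ifs with h
  · refine Finset.sum_congr rfl fun j _ => ?_
    by_cases hj : a j = c
    · simp [hj]
    · simp [hj, h, Ne.symm hj]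
  · refine Finset.sum_eq_zero fun j _ => ?_
    by_cases hj : a j = c
    · rw [if_neg (fun h' => h (h'.trans hj)), zero_mul]
    · rw [if_neg hj, mul_zero]

/-- Accretivity depends only on the Hermitian part. -/
theorem Accretive.congr {M N : Matrix ι ι ℂ} (hM : Accretive M) (h : M + Mᴴ = N + Nᴴ) :
    Accretive N := by
  intro v hv
  have h1 := congrArg (fun X : Matrix ι ι ℂ => (star v ⬝ᵥ X *ᵥ v).re) h
  simp only [Matrix.add_mulVec, dotProduct_add, Complex.add_re,
    re_star_dotProduct_conjTranspose] at h1
  have := hM v hv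
  linarith

variable [DecidableEq ι]

theorem Accretive.conj {M R : Matrix ι ι ℂ} (hM : Accretive M) (hR : IsUnit R.det) :
    Accretive (Rᴴ * M * R) := by
  intro v hv
  have hRv : R *ᵥ v ≠ 0 := fun h0 => hv (by
    rw [← Matrix.one_mulVec v, ← Matrix.nonsing_inv_mul _ hR, ← Matrix.mulVec_mulVec, h0,
      Matrix.mulVec_zero])
  have := hM _ hRv
  rwa [Matrix.star_mulVec, ← Matrix.dotProduct_mulVec, Matrix.mulVec_mulVec,
    Matrix.mulVec_mulVec] at this

/-- If the spectrum of `G` lies in `Re ≤ -θ`, the characteristic polynomial at a point of the closed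
right half-plane is bounded below by its values further to the right. -/
theorem norm_det_shift_le (G : Matrix ι ι ℂ) {θ : ℝ} (hθ : 0 < θ)
    (hG : ∀ μ ∈ spectrum ℂ G, μ.re ≤ -θ) {z : ℂ} (hz : 0 ≤ z.re) {t : ℝ} (ht : 0 ≤ t) :
    θ ^ Fintype.card ι * ‖((z + t) • (1 : Matrix ι ι ℂ) - G).det‖ ≤
      (θ + t) ^ Fintype.card ι * ‖(z • (1 : Matrix ι ι ℂ) - G).det‖ := by
  have hsplit := IsAlgClosed.splits G.charpoly
  have hcard : Multiset.card G.charpoly.roots = Fintype.card ι := by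
    rw [← hsplit.natDegree_eq_card_roots, Matrix.charpoly_natDegree_eq_dim]
  have hdet : ∀ w : ℂ, (w • (1 : Matrix ι ι ℂ) - G).det =
      (G.charpoly.roots.map fun μ => w - μ).prod := fun w => by
    rw [← hsplit.eval_eq_prod_roots_of_monic (Matrix.charpoly_monic G), Matrix.eval_charpoly]
    congr 2
    rw [Matrix.smul_one_eq_diagonal]; rfl
  have hnorm : ∀ w : ℂ, ‖(w • (1 : Matrix ι ι ℂ) - G).det‖ =
      (G.charpoly.roots.map fun μ => ‖w - μ‖).prod := fun w => by
    rw [hdet]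
    refine (map_multiset_prod (normHom : ℂ →*₀ ℝ) _).trans ?_
    rw [Multiset.map_map]; rfl
  rw [hnorm, hnorm, ← hcard, ← Multiset.prod_replicate, ← Multiset.prod_replicate,
    ← Multiset.map_const', ← Multiset.map_const', ← Multiset.prod_map_mul, ← Multiset.prod_map_mul]
  refine Multiset.prod_map_le_prod_map₀ _ _ (fun μ _ => by positivity) fun μ hμ => ?_
  have h1 : μ.re ≤ -θ := hG μ (Matrix.mem_spectrum_iff_isRoot_charpoly.mpr
    (Polynomial.isRoot_of_mem_roots hμ))
  have h2 : θ ≤ ‖z - μ‖ := by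
    have := Complex.re_le_norm (z - μ)
    rw [Complex.sub_re] at this
    linarith
  have h3 : ‖z + t - μ‖ ≤ ‖z - μ‖ + t := by
    calc ‖z + t - μ‖ = ‖(z - μ) + t‖ := by congr 1; ring
      _ ≤ ‖z - μ‖ + ‖(t : ℂ)‖ := norm_add_le _ _
      _ = ‖z - μ‖ + t := by rw [Complex.norm_real, Real.norm_of_nonneg ht]
  nlinarith

/-- High-frequency stability: if the spectrum of `iξ diag(a) + Q` stays in `Re ≤ -θ` as `ξ → ∞`,
then the block diagonal part of `Q` is stable. -/
theorem re_neg_of_blockPart_mulVec (a : ι → ℝ) (Q : Matrix ι ι ℂ) {θ : ℝ} (hθ : 0 < θ)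
    (hstab : ∀ ξ : ℝ, 1 ≤ ξ → ∀ μ ∈ spectrum ℂ
      ((Complex.I * ξ) • Matrix.diagonal (fun i => (a i : ℂ)) + Q), μ.re ≤ -θ)
    (μ : ℂ) (v : ι → ℂ) (hv : v ≠ 0) (hQv : blockPart a Q *ᵥ v = μ • v) : μ.re < 0 := by
  by_contra! hμ
  obtain ⟨i₀, hi₀⟩ := Function.ne_iff.mp hv
  set c := a i₀ with hc
  set D := Matrix.diagonal (fun i => (a i : ℂ)) with hD
  -- the rows outside the block `a = c` are rescaled by `ξ⁻¹ = s`; the limit `s → 0` decouples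
  let N : ℂ → ℝ → Matrix ι ι ℂ := fun z s => Matrix.of fun i j =>
    if a i = c then z * (1 : Matrix ι ι ℂ) i j - Q i j else
      (s : ℂ) * (z * (1 : Matrix ι ι ℂ) i j - Q i j) -
        Complex.I * (a i - c) * (1 : Matrix ι ι ℂ) i j
  have hNcont : ∀ z, Continuous fun s => (N z s).det := fun z => by
    refine Continuous.matrix_det (continuous_matrix fun i j => ?_)
    simp only [N, Matrix.of_apply]
    split_ifs <;> fun_prop
  have hN : ∀ z (s : ℝ), 0 < s → N z s = Matrix.diagonal (fun i => if a i = c then 1 else (s : ℂ)) *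
      ((z + Complex.I * ((s⁻¹ : ℝ) : ℂ) * c) • (1 : Matrix ι ι ℂ) -
        ((Complex.I * ((s⁻¹ : ℝ) : ℂ)) • D + Q)) := by
    intro z s hs
    have hsC : (s : ℂ) ≠ 0 := by exact_mod_cast hs.ne'
    ext i j
    rw [Matrix.diagonal_mul]
    simp only [N, hD, Matrix.of_apply, Matrix.sub_apply, Matrix.add_apply, Matrix.smul_apply,
      smul_eq_mul, Matrix.one_apply, Matrix.diagonal_apply]
    by_cases hij : i = j
    · subst hij
      simp only [if_true]
      split_ifs with h
      · rw [h]; ring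
      · push_cast; field_simp; ring
    · simp only [hij, if_false]
      split_ifs with h
      · ring
      · ring
  have hpos : ∀ t : ℝ, 0 ≤ t → ∀ s : ℝ, 0 < s → s ≤ 1 →
      θ ^ Fintype.card ι * ‖(N (μ + t) s).det‖ ≤ (θ + t) ^ Fintype.card ι * ‖(N μ s).det‖ := by
    intro t ht s hs hs1
    have h1 := norm_det_shift_le _ hθ (hstab s⁻¹ ((one_le_inv₀ hs).mpr hs1))
      (z := μ + Complex.I * ((s⁻¹ : ℝ) : ℂ) * c) (by
        have : (Complex.I * ((s⁻¹ : ℝ) : ℂ) * c).re = 0 := by simp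
        rw [Complex.add_re, this, add_zero]; exact hμ) ht
    rw [hN _ s hs, hN _ s hs, Matrix.det_mul, Matrix.det_mul, norm_mul, norm_mul,
      show μ + t + Complex.I * ((s⁻¹ : ℝ) : ℂ) * c = μ + Complex.I * ((s⁻¹ : ℝ) : ℂ) * c + t by ring,
      mul_left_comm, mul_left_comm ((θ + t) ^ _)]
    gcongr
  have hlim : ∀ t : ℝ, 0 ≤ t →
      θ ^ Fintype.card ι * ‖(N (μ + t) 0).det‖ ≤ (θ + t) ^ Fintype.card ι * ‖(N μ 0).det‖ := by
    intro t ht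
    have hl : ∀ z, Tendsto (fun s => ‖(N z s).det‖) (𝓝[>] 0) (𝓝 ‖(N z 0).det‖) := fun z =>
      ((hNcont z).norm.tendsto 0).mono_left nhdsWithin_le_nhds
    refine le_of_tendsto_of_tendsto ((hl _).const_mul _) ((hl _).const_mul _) ?_
    filter_upwards [Ioc_mem_nhdsGT one_pos] with s hs
    exact hpos t ht s hs.1 hs.2
  -- a kernel vector of the limit is an eigenvector of the block
  have hker : ∀ z (u : ι → ℂ), N z 0 *ᵥ u = 0 ↔
      (∀ i, a i ≠ c → u i = 0) ∧ ∀ i, a i = c → (Q *ᵥ u) i = z * u i := by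
    intro z u
    have hrow : ∀ i, (N z 0 *ᵥ u) i = if a i = c then z * u i - (Q *ᵥ u) i else
        -(Complex.I * (a i - c) * u i) := by
      intro i
      simp only [Matrix.mulVec, dotProduct, N, Matrix.of_apply]
      split_ifs with h
      · simp only [sub_mul, Finset.sum_sub_distrib, mul_assoc, Matrix.one_apply, ite_mul, one_mul,
          zero_mul, mul_ite, mul_zero, Finset.sum_ite_eq, Finset.mem_univ, if_true]
      · simp [Matrix.one_apply]
    constructor
    · intro h
      refine ⟨fun i hi => ?_, fun i hi => ?_⟩
      · have := congrFun h i
        rw [hrow, if_neg hi] at this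
        have h2 : (a i : ℂ) - c ≠ 0 := by rw [sub_ne_zero]; exact_mod_cast hi
        simpa [h2] using this
      · have := congrFun h i
        rw [hrow, if_pos hi] at this
        exact (sub_eq_zero.mp this).symm
    · rintro ⟨h1, h2⟩
      funext i
      rw [hrow]
      split_ifs with h
      · rw [h2 i h, sub_self]; rfl
      · rw [h1 i h]; simp
  have hblock : ∀ u : ι → ℂ, (∀ i, a i ≠ c → u i = 0) → ∀ i, a i = c →
      (blockPart a Q *ᵥ u) i = (Q *ᵥ u) i := by
    intro u hu i hi
    simp only [Matrix.mulVec, dotProduct, blockPart_apply]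
    refine Finset.sum_congr rfl fun j _ => ?_
    by_cases hj : a j = c
    · rw [if_pos (hi.trans hj.symm)]
    · rw [hu j hj]; simp
  have hdet0 : (N μ 0).det = 0 := by
    rw [← Matrix.exists_mulVec_eq_zero_iff]
    refine ⟨fun i => if a i = c then v i else 0, Function.ne_iff.mpr ⟨i₀, by simpa [hc] using hi₀⟩,
      (hker _ _).mpr ⟨fun i hi => by simp [hi], fun i hi => ?_⟩⟩
    rw [← hblock _ (fun i hi => by simp [hi]) i hi, blockPart_mulVec_restrict, hQv]
    simp [hi]
  have hspec : ∀ t : ℝ, 0 ≤ t → (blockPart a Q).charpoly.IsRoot (μ + t) := by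
    intro t ht
    have h1 : (N (μ + t) 0).det = 0 := by
      have := hlim t ht
      rw [hdet0, norm_zero, mul_zero] at this
      have h2 : 0 < θ ^ Fintype.card ι := by positivity
      exact norm_eq_zero.mp (le_antisymm (by nlinarith [norm_nonneg (N (μ + t) 0).det])
        (norm_nonneg _))
    obtain ⟨u, hu, hNu⟩ := Matrix.exists_mulVec_eq_zero_iff.mpr h1
    obtain ⟨hu1, hu2⟩ := (hker _ _).mp hNu
    rw [← Matrix.mem_spectrum_iff_isRoot_charpoly, mem_spectrum_iff_exists_mulVec]
    refine ⟨u, hu, ?_⟩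
    funext i
    by_cases hi : a i = c
    · rw [hblock u hu1 i hi, hu2 i hi]; rfl
    · have hrest : u = fun i => if a i = c then u i else 0 := by
        funext j
        by_cases hj : a j = c
        · simp [hj]
        · simp [hj, hu1 j hj]
      have h3 := congrFun (blockPart_mulVec_restrict a Q u c) i
      rw [← hrest, if_neg hi] at h3
      rw [h3, Pi.smul_apply, hu1 i hi, smul_zero]
  have hinf : (range fun t : ℕ => μ + ((t : ℝ) : ℂ)).Infinite :=
    infinite_range_of_injective fun s t hst => by simpa using hst
  refine hinf ((Polynomial.finite_setOfPred_isRoot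
    (Matrix.charpoly_monic (blockPart a Q)).ne_zero).subset ?_)
  rintro _ ⟨t, rfl⟩
  exact hspec t (Nat.cast_nonneg t)

/-- The compensating matrix in coordinates that diagonalize the flux matrix. The symmetrizer is
block diagonal, built from a Lyapunov matrix of the block part of `Q`, and the compensator removes
the off-diagonal blocks of the Hermitian part of `D S Q`. -/
theorem exists_compensator_diagonal (a : ι → ℝ) (ha : ∀ i, a i ≠ 0) (Q : Matrix ι ι ℂ) {θ : ℝ}
    (hθ : 0 < θ) (hstab : ∀ ξ : ℝ, 1 ≤ ξ → ∀ μ ∈ spectrum ℂ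
      ((Complex.I * ξ) • Matrix.diagonal (fun i => (a i : ℂ)) + Q), μ.re ≤ -θ) :
    ∃ S K : Matrix ι ι ℂ, S.IsHermitian ∧ K.IsHermitian ∧
      S * Matrix.diagonal (fun i => (a i : ℂ)) = Matrix.diagonal (fun i => (a i : ℂ)) * S ∧
      Accretive (-(Matrix.diagonal (fun i => (a i : ℂ)) * S)) ∧
      Accretive (Matrix.diagonal (fun i => (a i : ℂ)) * S * Q -
        Complex.I • (Matrix.diagonal (fun i => (a i : ℂ)) * K)) := by
  set D := Matrix.diagonal (fun i => (a i : ℂ)) with hD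
  have haC : ∀ i, (a i : ℂ) ≠ 0 := fun i => by exact_mod_cast ha i
  have hQd := re_neg_of_blockPart_mulVec a Q hθ hstab
  obtain ⟨S₁, hS₁, hacc, hneg⟩ := exists_lyapunov_matrix (blockPart a Q)
    (fun μ x hx h => (hQd μ x hx h).ne)
  have hP : (blockPart a S₁).IsHermitian := by
    rw [Matrix.IsHermitian, blockPart_conjTranspose, hS₁.eq]
  set H := blockPart a S₁ * Q + (blockPart a S₁ * Q)ᴴ with hH
  have hHH : ∀ i j, star (H j i) = H i j := fun i j => by
    have : Hᴴ = H := by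
      rw [hH, Matrix.conjTranspose_add, Matrix.conjTranspose_conjTranspose, add_comm]
    rw [← Matrix.conjTranspose_apply, this]
  let S : Matrix ι ι ℂ := Matrix.of fun i j => blockPart a S₁ i j / a j
  -- `K` solves the homological equation that removes the off-diagonal blocks of `H`
  let K : Matrix ι ι ℂ := Matrix.of fun i j =>
    if a i = a j then 0 else -Complex.I * H i j / (a i - a j)
  have hSD : S * D = blockPart a S₁ := by
    ext i j
    rw [hD, Matrix.mul_diagonal]
    simp only [S, Matrix.of_apply]
    rw [div_mul_cancel₀ _ (haC j)]
  have hDS : D * S = blockPart a S₁ := by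
    ext i j
    rw [hD, Matrix.diagonal_mul]
    simp only [S, Matrix.of_apply, blockPart_apply]
    split_ifs with h
    · rw [h, mul_div_cancel₀ _ (haC j)]
    · simp
  have hKH : K.IsHermitian := by
    ext i j
    simp only [Matrix.conjTranspose_apply, K, Matrix.of_apply, eq_comm (a := a j)]
    split_ifs with h
    · simp
    · have h1 : (a i : ℂ) - a j ≠ 0 := by rw [sub_ne_zero]; exact_mod_cast h
      have h2 : (a j : ℂ) - a i ≠ 0 := by rw [sub_ne_zero]; exact_mod_cast Ne.symm h
      rw [star_div₀, star_mul', star_neg, hHH]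
      simp only [star_sub, Complex.star_def, Complex.conj_I, Complex.conj_ofReal]
      field_simp
      ring
  refine ⟨S, K, ?_, hKH, by rw [hSD, hDS], ?_, ?_⟩
  · ext i j
    have h1 : star (blockPart a S₁ j i) = blockPart a S₁ i j := by
      rw [← Matrix.conjTranspose_apply, hP.eq]
    simp only [Matrix.conjTranspose_apply, S, Matrix.of_apply]
    rw [star_div₀, h1]
    simp only [Complex.star_def, Complex.conj_ofReal, blockPart_apply]
    split_ifs with h
    · rw [h]
    · simp
  · have := (hneg hQd).blockPart a
    rw [hDS]
    convert this using 1
    ext i j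
    simp only [blockPart_apply, Matrix.neg_apply]
    split_ifs <;> simp
  · have h1 : Accretive (blockPart a (blockPart a S₁ * Q)) := by
      rw [blockPart_mul_right, blockPart_mul]
      exact hacc.blockPart a
    refine h1.congr ?_
    rw [hDS]
    have hDH : Dᴴ = D := by
      rw [hD, Matrix.diagonal_conjTranspose]; congr 1; funext i; simp
    have h2 : blockPart a (blockPart a S₁ * Q) + (blockPart a (blockPart a S₁ * Q))ᴴ =
        blockPart a H := by
      rw [blockPart_conjTranspose]
      ext i j
      simp only [Matrix.add_apply, blockPart_apply, hH]
      split_ifs <;> simp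
    have h3 : (blockPart a S₁ * Q - Complex.I • (D * K)) + (blockPart a S₁ * Q -
        Complex.I • (D * K))ᴴ = H - Complex.I • (D * K - K * D) := by
      rw [Matrix.conjTranspose_sub, Matrix.conjTranspose_smul, Matrix.conjTranspose_mul D K,
        hKH.eq, hDH, hH, Complex.star_def, Complex.conj_I, neg_smul, smul_sub]
      abel
    rw [h2, h3]
    ext i j
    rw [blockPart_apply, Matrix.sub_apply, Matrix.smul_apply, Matrix.sub_apply, hD,
      Matrix.diagonal_mul, Matrix.mul_diagonal]
    simp only [K, Matrix.of_apply, smul_eq_mul]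
    split_ifs with h
    · simp
    · have h1 : (a i : ℂ) - a j ≠ 0 := by rw [sub_ne_zero]; exact_mod_cast h
      rw [show Complex.I * ((a i : ℂ) * (-Complex.I * H i j / (a i - a j)) -
          -Complex.I * H i j / (a i - a j) * a j) =
          -(Complex.I * Complex.I) * H i j * (((a i : ℂ) - a j) / (a i - a j)) by ring,
        Complex.I_mul_I, div_self h1]
      ring

/-- **Kawashima's compensator**: if the spectrum of `iξA + Q` stays in `Re ≤ -θ` at high frequency,
there are a symmetrizer `S` of `A`, with `AᴴS` negative definite, and a Hermitian matrix `K` such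
that `AᴴSQ - iAᴴK` is accretive. -/
theorem exists_compensator (A Q T : Matrix ι ι ℂ) (hT : IsUnit T.det) (a : ι → ℝ)
    (ha : ∀ i, a i ≠ 0) (hAT : A * T = T * Matrix.diagonal fun i => (a i : ℂ)) {θ : ℝ}
    (hθ : 0 < θ) (hstab : ∀ ξ : ℝ, 1 ≤ ξ → ∀ μ ∈ spectrum ℂ ((Complex.I * ξ) • A + Q),
      μ.re ≤ -θ) :
    ∃ S K : Matrix ι ι ℂ, S.IsHermitian ∧ K.IsHermitian ∧ S * A = Aᴴ * S ∧
      Accretive (-(Aᴴ * S)) ∧ Accretive (Aᴴ * S * Q - Complex.I • (Aᴴ * K)) := by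
  set D := Matrix.diagonal fun i => (a i : ℂ) with hD
  have hDH : Dᴴ = D := by
    rw [hD, Matrix.diagonal_conjTranspose]; congr 1; funext i; simp
  set R := T⁻¹
  have hTR : T * R = 1 := Matrix.mul_nonsing_inv _ hT
  have hRT : R * T = 1 := Matrix.nonsing_inv_mul _ hT
  have hRdet : IsUnit R.det := Matrix.isUnit_nonsing_inv_det _ hT
  have hA : A = T * D * R := by rw [← hAT, Matrix.mul_assoc, hTR, Matrix.mul_one]
  have hAH : Aᴴ * Rᴴ = Rᴴ * D := by
    rw [← Matrix.conjTranspose_mul, hA]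
    have : R * (T * D * R) = D * R := by
      rw [← Matrix.mul_assoc, ← Matrix.mul_assoc, hRT, Matrix.one_mul]
    rw [this, Matrix.conjTranspose_mul, hDH]
  have hRA : R * A = D * R := by
    rw [hA, ← Matrix.mul_assoc, ← Matrix.mul_assoc, hRT, Matrix.one_mul]
  obtain ⟨S, K, hS, hK, hSD, hacc1, hacc2⟩ := exists_compensator_diagonal a ha (R * Q * T) hθ
    (fun ξ hξ μ hμ => by
      obtain ⟨v, hv, hvμ⟩ := (mem_spectrum_iff_exists_mulVec _ _).mp hμ
      refine hstab ξ hξ μ ((mem_spectrum_iff_exists_mulVec _ _).mpr ⟨T *ᵥ v, fun h0 => hv ?_, ?_⟩)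
      · rw [← Matrix.one_mulVec v, ← hRT, ← Matrix.mulVec_mulVec, h0, Matrix.mulVec_zero]
      · have h1 : ((Complex.I * ξ) • A + Q) * T = T * ((Complex.I * ξ) • D + R * Q * T) := by
          rw [Matrix.add_mul, Matrix.mul_add, Matrix.smul_mul, Matrix.mul_smul, hAT]
          congr 1
          rw [← Matrix.mul_assoc, ← Matrix.mul_assoc, hTR, Matrix.one_mul]
        rw [Matrix.mulVec_mulVec, h1, ← Matrix.mulVec_mulVec, hvμ, Matrix.mulVec_smul])
  refine ⟨Rᴴ * S * R, Rᴴ * K * R, Matrix.isHermitian_conjTranspose_mul_mul R hS,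
    Matrix.isHermitian_conjTranspose_mul_mul R hK, ?_, ?_, ?_⟩
  · rw [Matrix.mul_assoc, hRA, ← Matrix.mul_assoc, Matrix.mul_assoc Rᴴ S D, hSD,
      ← Matrix.mul_assoc, ← Matrix.mul_assoc Aᴴ, ← Matrix.mul_assoc Aᴴ, hAH]
  · have h1 : -(Aᴴ * (Rᴴ * S * R)) = Rᴴ * (-(D * S)) * R := by
      rw [← Matrix.mul_assoc, ← Matrix.mul_assoc, hAH]
      simp only [Matrix.mul_neg, Matrix.neg_mul, Matrix.mul_assoc]
    rw [h1]
    exact hacc1.conj hRdet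
  · have h1 : Aᴴ * (Rᴴ * S * R) * Q - Complex.I • (Aᴴ * (Rᴴ * K * R)) =
        Rᴴ * (D * S * (R * Q * T) - Complex.I • (D * K)) * R := by
      rw [Matrix.mul_sub, Matrix.sub_mul, ← Matrix.mul_assoc Aᴴ, ← Matrix.mul_assoc Aᴴ, hAH,
        ← Matrix.mul_assoc Aᴴ, ← Matrix.mul_assoc Aᴴ, hAH]
      congr 1
      · calc Rᴴ * D * S * R * Q = Rᴴ * D * S * R * Q * (T * R) := by rw [hTR, Matrix.mul_one]
          _ = _ := by simp only [Matrix.mul_assoc]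
      · simp only [Matrix.mul_assoc, Matrix.mul_smul, Matrix.smul_mul]
    rw [h1]
    exact hacc2.conj hRdet

end Compensator

/-! ### The energy estimate at high frequency -/

section HighFrequency

variable {ι : Type} [Fintype ι]

theorem exists_form_bound (M : Matrix ι ι ℂ) : ∃ C, 0 ≤ C ∧ ∀ᶠ M' in 𝓝 M, ∀ v : ι → ℂ,
    ‖star v ⬝ᵥ M' *ᵥ v‖ ≤ C * ‖v‖ ^ 2 := by
  obtain ⟨D, hD, hev⟩ := exists_mulVec_bound M
  refine ⟨Fintype.card ι * D, by positivity, ?_⟩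
  filter_upwards [hev] with M' hM' v
  refine (norm_star_dotProduct_le _ _).trans ?_
  calc (Fintype.card ι : ℝ) * (‖v‖ * ‖M' *ᵥ v‖) ≤ Fintype.card ι * (‖v‖ * (D * ‖v‖)) := by
        gcongr; exact hM' v
    _ = _ := by ring

theorem star_mulVec_dotProduct_mulVec (A S B : Matrix ι ι ℂ) (v : ι → ℂ) :
    star (A *ᵥ v) ⬝ᵥ S *ᵥ (B *ᵥ v) = star v ⬝ᵥ (Aᴴ * S * B) *ᵥ v := by
  rw [Matrix.star_mulVec, ← Matrix.dotProduct_mulVec, Matrix.mulVec_mulVec, Matrix.mulVec_mulVec,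
    Matrix.mul_assoc]

theorem Matrix.IsHermitian.im_star_dotProduct_mulVec {S : Matrix ι ι ℂ} (hS : S.IsHermitian)
    (v : ι → ℂ) : (star v ⬝ᵥ S *ᵥ v).im = 0 := by
  have := congrArg Complex.im (hS.star_dotProduct_mulVec v v)
  rw [Complex.conj_im] at this
  linarith

/-- The purely algebraic lower bound behind the high-frequency estimate: `X` plays the role of
`AᴴSQ - iAᴴK` up to small terms, `Y` of `AᴴS`, and `β = Im λ / |λ|²` is the weight of the
compensator. -/
theorem re_form_lower_bound {c₁ c₂ C : ℝ}
    {X Y Z₁ Z₂ : Matrix ι ι ℂ} (hY : Y.IsHermitian) (v : ι → ℂ)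
    (hX : c₁ * ‖v‖ ^ 2 ≤ (star v ⬝ᵥ X *ᵥ v).re) (hYv : c₂ * ‖v‖ ^ 2 ≤ (star v ⬝ᵥ (-Y) *ᵥ v).re)
    (hZ₁ : ‖star v ⬝ᵥ Z₁ *ᵥ v‖ ≤ C * ‖v‖ ^ 2) (hZ₂ : ‖star v ⬝ᵥ Z₂ *ᵥ v‖ ≤ C * ‖v‖ ^ 2)
    {lam : ℂ} (hre : 0 ≤ lam.re) (hl0 : 0 < ‖lam‖) (hl1 : 2 * C ≤ c₁ * ‖lam‖)
    (hl2 : 2 * C ≤ c₂ * ‖lam‖) :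
    c₁ / 2 * ‖v‖ ^ 2 ≤ (star v ⬝ᵥ (X - lam • Y + ((lam.im / ‖lam‖ ^ 2 : ℝ) : ℂ) • Z₁ +
      (Complex.I - lam * ((lam.im / ‖lam‖ ^ 2 : ℝ) : ℂ)) • Z₂) *ᵥ v).re := by
  set β : ℝ := lam.im / ‖lam‖ ^ 2 with hβ
  set r := ‖lam‖ with hr
  have hab : lam.re ^ 2 + lam.im ^ 2 = r ^ 2 := by
    rw [hr, ← Complex.normSq_eq_norm_sq, Complex.normSq_apply]; ring
  have har : lam.re ≤ r := Complex.re_le_norm lam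
  have hbr : |lam.im| ≤ r := Complex.abs_im_le_norm lam
  have hβr : |β| ≤ 1 / r := by
    rw [hβ, abs_div, abs_of_nonneg (sq_nonneg r), div_le_div_iff₀ (by positivity) hl0]
    nlinarith
  -- `i - λβ` is small compared with `Re λ`
  have hrest : ‖Complex.I - lam * (β : ℂ)‖ ≤ 2 * lam.re / r := by
    refine (Complex.norm_le_abs_re_add_abs_im _).trans ?_
    have h1 : (Complex.I - lam * (β : ℂ)).re = -(lam.re * β) := by simp
    have h2 : (Complex.I - lam * (β : ℂ)).im = lam.re ^ 2 / r ^ 2 := by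
      have : (Complex.I - lam * (β : ℂ)).im = 1 - lam.im * β := by simp
      rw [this, hβ, eq_div_iff (by positivity)]
      field_simp
      linarith
    rw [h1, h2, abs_neg, abs_mul, abs_of_nonneg hre,
      abs_of_nonneg (show 0 ≤ lam.re ^ 2 / r ^ 2 by positivity)]
    have h3 : lam.re * |β| ≤ lam.re * (1 / r) := by gcongr
    have h4 : lam.re ^ 2 / r ^ 2 ≤ lam.re * (1 / r) := by
      rw [mul_one_div, div_le_div_iff₀ (by positivity) hl0]
      nlinarith [mul_nonneg hre hl0.le]
    calc _ ≤ lam.re * (1 / r) + lam.re * (1 / r) := add_le_add h3 h4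
      _ = _ := by ring
  have hYre : (lam * (star v ⬝ᵥ Y *ᵥ v)).re = lam.re * (star v ⬝ᵥ Y *ᵥ v).re := by
    rw [Complex.mul_re, hY.im_star_dotProduct_mulVec, mul_zero, sub_zero]
  have hYv' : (star v ⬝ᵥ Y *ᵥ v).re ≤ -(c₂ * ‖v‖ ^ 2) := by
    rw [Matrix.neg_mulVec, dotProduct_neg, Complex.neg_re] at hYv
    linarith
  have e : (star v ⬝ᵥ (X - lam • Y + (β : ℂ) • Z₁ + (Complex.I - lam * (β : ℂ)) • Z₂) *ᵥ v) =
      star v ⬝ᵥ X *ᵥ v - lam * (star v ⬝ᵥ Y *ᵥ v) + β * (star v ⬝ᵥ Z₁ *ᵥ v) +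
        (Complex.I - lam * (β : ℂ)) * (star v ⬝ᵥ Z₂ *ᵥ v) := by
    simp only [Matrix.add_mulVec, Matrix.sub_mulVec, Matrix.smul_mulVec, dotProduct_add,
      dotProduct_sub, dotProduct_smul, smul_eq_mul]
  rw [e, Complex.add_re, Complex.add_re, Complex.sub_re, hYre]
  have h5 : -(1 / r * (C * ‖v‖ ^ 2)) ≤ ((β : ℂ) * (star v ⬝ᵥ Z₁ *ᵥ v)).re := by
    refine neg_le_of_abs_le ((Complex.abs_re_le_norm _).trans ?_)
    rw [norm_mul, Complex.norm_real, Real.norm_eq_abs]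
    gcongr
  have h6 : -(2 * lam.re / r * (C * ‖v‖ ^ 2)) ≤
      ((Complex.I - lam * (β : ℂ)) * (star v ⬝ᵥ Z₂ *ᵥ v)).re := by
    refine neg_le_of_abs_le ((Complex.abs_re_le_norm _).trans ?_)
    rw [norm_mul]
    gcongr
  have h7 : 1 / r * (C * ‖v‖ ^ 2) ≤ c₁ / 2 * ‖v‖ ^ 2 := by
    rw [← mul_assoc, one_div_mul_eq_div]
    refine mul_le_mul_of_nonneg_right ?_ (sq_nonneg _)
    rw [div_le_iff₀ hl0]; linarith
  have h8 : 2 * lam.re / r * (C * ‖v‖ ^ 2) ≤ lam.re * (c₂ * ‖v‖ ^ 2) := by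
    have : 2 * lam.re / r * (C * ‖v‖ ^ 2) = lam.re * (2 * C / r * ‖v‖ ^ 2) := by ring
    rw [this]
    gcongr
    rw [div_le_iff₀ hl0]; linarith
  have h9 := mul_le_mul_of_nonneg_left hYv' hre
  linarith

variable [DecidableEq ι]

/-- With a `C¹` family of symmetrizers `S` and a compensator `K` at the base point, the energy
`Re zᴴ(S + βK)z`, `β = Im λ/|λ|²`, of `z = A v` controls `‖v‖²` for all large `λ` in the right
half-plane, as long as the state stays near the base point and varies slowly. -/
theorem exists_highFrequency_energy {P : Type*} [NormedAddCommGroup P] [NormedSpace ℝ P]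
    {A Q S : P → Matrix ι ι ℂ} {K : Matrix ι ι ℂ} {p₀ : P} (hA : ContinuousAt A p₀)
    (hQ : ContinuousAt Q p₀) (hS : ∀ i j, ContDiffAt ℝ 1 (fun p => S p i j) p₀)
    (hSH : ∀ p, (S p).IsHermitian) (hsym : ∀ᶠ p in 𝓝 p₀, S p * A p = (A p)ᴴ * S p)
    (hneg : Accretive (-((A p₀)ᴴ * S p₀)))
    (hacc : Accretive ((A p₀)ᴴ * S p₀ * Q p₀ - Complex.I • ((A p₀)ᴴ * K))) :
    ∃ R > 0, ∃ c > 0, ∃ D, ∀ᶠ y : P × P in 𝓝 (p₀, 0),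
      (∀ i j, DifferentiableAt ℝ (fun p => S p i j) y.1) ∧
      ∀ lam : ℂ, 0 ≤ lam.re → R ≤ ‖lam‖ → ∀ v : ι → ℂ,
        c * ‖v‖ ^ 2 ≤ 2 * (star (A y.1 *ᵥ v) ⬝ᵥ
            (S y.1 + ((lam.im / ‖lam‖ ^ 2 : ℝ) : ℂ) • K) *ᵥ (Q y.1 *ᵥ v - lam • v)).re +
          (star (A y.1 *ᵥ v) ⬝ᵥ
            (Matrix.of fun i j => fderiv ℝ (fun p => S p i j) y.1 y.2) *ᵥ (A y.1 *ᵥ v)).re ∧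
        |(star (A y.1 *ᵥ v) ⬝ᵥ
            (S y.1 + ((lam.im / ‖lam‖ ^ 2 : ℝ) : ℂ) • K) *ᵥ (A y.1 *ᵥ v)).re| ≤ D * ‖v‖ ^ 2 := by
  have hfst : Tendsto (Prod.fst : P × P → P) (𝓝 (p₀, 0)) (𝓝 p₀) := continuousAt_fst
  have hSc : ContinuousAt S p₀ :=
    continuousAt_pi.mpr fun i => continuousAt_pi.mpr fun j => (hS i j).continuousAt
  let dS : P × P → Matrix ι ι ℂ := fun y => Matrix.of fun i j => fderiv ℝ (fun p => S p i j) y.1 y.2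
  have hdS0 : dS (p₀, 0) = 0 := by ext i j; simp [dS]
  have hdS : Tendsto dS (𝓝 (p₀, 0)) (𝓝 0) := by
    rw [← hdS0]
    refine tendsto_pi_nhds.mpr fun i => tendsto_pi_nhds.mpr fun j => ?_
    have h1 : ContinuousAt (fderiv ℝ fun p => S p i j) p₀ :=
      ((hS i j).fderiv_right (m := 0) (by norm_num)).continuousAt
    have h2 : ContinuousAt (fun y : P × P => fderiv ℝ (fun p => S p i j) y.1) (p₀, 0) :=
      h1.tendsto.comp hfst
    exact h2.clm_apply continuousAt_snd
  have hA' : Tendsto (fun y : P × P => A y.1) (𝓝 (p₀, 0)) (𝓝 (A p₀)) := hA.tendsto.comp hfst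
  have hQ' : Tendsto (fun y : P × P => Q y.1) (𝓝 (p₀, 0)) (𝓝 (Q p₀)) := hQ.tendsto.comp hfst
  have hS' : Tendsto (fun y : P × P => S y.1) (𝓝 (p₀, 0)) (𝓝 (S p₀)) := hSc.tendsto.comp hfst
  have hAH : Tendsto (fun y : P × P => (A y.1)ᴴ) (𝓝 (p₀, 0)) (𝓝 (A p₀)ᴴ) :=
    (continuous_id.matrix_conjTranspose.tendsto _).comp hA'
  have hXt : Tendsto (fun y : P × P => (A y.1)ᴴ * S y.1 * Q y.1 - Complex.I • ((A y.1)ᴴ * K) +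
      (1 / 2 : ℂ) • ((A y.1)ᴴ * dS y * A y.1)) (𝓝 (p₀, 0))
      (𝓝 ((A p₀)ᴴ * S p₀ * Q p₀ - Complex.I • ((A p₀)ᴴ * K))) := by
    have h1 := ((((hAH.mul hS').mul hQ').sub ((hAH.mul (tendsto_const_nhds (x := K))).const_smul
      Complex.I))).add (((hAH.mul hdS).mul hA').const_smul (1 / 2 : ℂ))
    simpa using h1
  obtain ⟨c₁, hc₁, hX⟩ := hacc.eventually
  obtain ⟨c₂, hc₂, hY⟩ := hneg.eventually
  obtain ⟨C₁, hC₁, hZ₁⟩ := exists_form_bound ((A p₀)ᴴ * K * Q p₀)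
  obtain ⟨C₂, hC₂, hZ₂⟩ := exists_form_bound ((A p₀)ᴴ * K)
  obtain ⟨C₃, hC₃, hZ₃⟩ := exists_form_bound ((A p₀)ᴴ * S p₀ * A p₀)
  obtain ⟨C₄, hC₄, hZ₄⟩ := exists_form_bound ((A p₀)ᴴ * K * A p₀)
  set C := C₁ + C₂
  have hC0 : 0 ≤ C := by positivity
  set R := 2 * C / c₁ + 2 * C / c₂ + 1
  have hR1 : 1 ≤ R := by
    have : 0 ≤ 2 * C / c₁ + 2 * C / c₂ := by positivity
    linarith
  have hKt : Tendsto (fun _ : P × P => K) (𝓝 (p₀, 0)) (𝓝 K) := tendsto_const_nhds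
  have hdiff : ∀ᶠ p in 𝓝 p₀, ∀ i j, DifferentiableAt ℝ (fun p => S p i j) p := by
    simp only [eventually_all]
    intro i j
    filter_upwards [(hS i j).eventually (by decide)] with p hp
    exact hp.differentiableAt one_ne_zero
  refine ⟨R, by linarith, c₁, hc₁, C₃ + C₄, ?_⟩
  filter_upwards [hXt.eventually hX, (hAH.mul hS').neg.eventually hY,
    ((hAH.mul hKt).mul hQ').eventually hZ₁, (hAH.mul hKt).eventually hZ₂,
    ((hAH.mul hS').mul hA').eventually hZ₃, ((hAH.mul hKt).mul hA').eventually hZ₄,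
    hfst.eventually hsym, hfst.eventually hdiff] with y h1 h2 h3 h4 h5 h6 h7 h8
  refine ⟨h8, fun lam hre hlam v => ⟨?_, ?_⟩⟩
  · have hl0 : 0 < ‖lam‖ := by linarith
    have hYH : ((A y.1)ᴴ * S y.1).IsHermitian := by
      rw [Matrix.IsHermitian, Matrix.conjTranspose_mul, (hSH _).eq,
        Matrix.conjTranspose_conjTranspose, h7]
    have hCle : 2 * C ≤ c₁ * ‖lam‖ := by
      have : 2 * C / c₁ ≤ ‖lam‖ := by
        have : 0 ≤ 2 * C / c₂ := by positivity
        linarith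
      rw [div_le_iff₀ hc₁] at this; linarith
    have hCle2 : 2 * C ≤ c₂ * ‖lam‖ := by
      have : 2 * C / c₂ ≤ ‖lam‖ := by
        have : 0 ≤ 2 * C / c₁ := by positivity
        linarith
      rw [div_le_iff₀ hc₂] at this; linarith
    have hmain := re_form_lower_bound hYH v (h1 v) (h2 v)
      ((h3 v).trans (by gcongr; linarith)) ((h4 v).trans (by gcongr; linarith)) hre hl0 hCle hCle2
    set β : ℂ := ((lam.im / ‖lam‖ ^ 2 : ℝ) : ℂ)
    have e1 : Q y.1 *ᵥ v - lam • v = (Q y.1 - lam • (1 : Matrix ι ι ℂ)) *ᵥ v := by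
      rw [Matrix.sub_mulVec, Matrix.smul_mulVec, Matrix.one_mulVec]
    rw [e1, star_mulVec_dotProduct_mulVec, star_mulVec_dotProduct_mulVec]
    have e2 : (A y.1)ᴴ * S y.1 * Q y.1 - Complex.I • ((A y.1)ᴴ * K) +
        (1 / 2 : ℂ) • ((A y.1)ᴴ * dS y * A y.1) - lam • ((A y.1)ᴴ * S y.1) +
        β • ((A y.1)ᴴ * K * Q y.1) + (Complex.I - lam * β) • ((A y.1)ᴴ * K) =
        (A y.1)ᴴ * (S y.1 + β • K) * (Q y.1 - lam • (1 : Matrix ι ι ℂ)) +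
          (1 / 2 : ℂ) • ((A y.1)ᴴ * dS y * A y.1) := by
      simp only [Matrix.mul_add, Matrix.add_mul, Matrix.mul_sub, Matrix.mul_smul,
        Matrix.smul_mul, Matrix.mul_one, sub_smul, mul_smul]
      module
    rw [e2, Matrix.add_mulVec, dotProduct_add, Complex.add_re, Matrix.smul_mulVec, dotProduct_smul,
      smul_eq_mul, show (1 / 2 : ℂ) = ((1 / 2 : ℝ) : ℂ) by push_cast; ring,
      Complex.re_ofReal_mul] at hmain
    linarith
  · have hβ : |lam.im / ‖lam‖ ^ 2| ≤ 1 := by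
      rw [abs_div, abs_of_nonneg (sq_nonneg ‖lam‖), div_le_one (by nlinarith)]
      have := Complex.abs_im_le_norm lam
      nlinarith
    rw [star_mulVec_dotProduct_mulVec]
    refine (Complex.abs_re_le_norm _).trans ?_
    rw [Matrix.mul_add, Matrix.add_mul, Matrix.add_mulVec, dotProduct_add, Matrix.mul_smul,
      Matrix.smul_mul, Matrix.smul_mulVec, dotProduct_smul]
    refine (norm_add_le _ _).trans ?_
    rw [norm_smul, Complex.norm_real, Real.norm_eq_abs, add_mul]
    refine add_le_add (h5 v) ?_
    calc _ ≤ 1 * (C₄ * ‖v‖ ^ 2) := by gcongr; exact h6 v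
      _ = _ := one_mul _

end HighFrequency

/-! ### Relaxation profiles -/

theorem contDiffAt_cMatrix {P V ι : Type*} [NormedAddCommGroup P] [NormedSpace ℝ P]
    [NormedAddCommGroup V] [NormedSpace ℝ V] [FiniteDimensional ℝ V] [Fintype ι] [DecidableEq ι]
    (b : Module.Basis ι ℝ V) {T : P → V →L[ℝ] V} {p₀ : P} (hT : ContDiffAt ℝ 1 T p₀) (i j : ι) :
    ContDiffAt ℝ 1 (fun p => cMatrix b (T p) i j) p₀ := by
  simp only [cMatrix_apply]
  have h1 : ContDiffAt ℝ 1 (fun p => LinearMap.toContinuousLinearMap (b.coord i) (T p (b j))) p₀ :=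
    (ContinuousLinearMap.contDiff _).contDiffAt.comp p₀ (hT.clm_apply contDiffAt_const)
  exact Complex.ofRealCLM.contDiff.contDiffAt.comp p₀ h1

section Relaxation

variable {n m : ℕ} {F : RVec n × RVec m → RVec n} {G q : RVec n × RVec m → RVec m}
  {vstar : RVec n → RVec m} {U : Set (RVec n × RVec m)} {V : Set (RVec n)} {u₀ : RVec n}

theorem RelaxationHypotheses.mem_U (H : RelaxationHypotheses F G q vstar U V u₀) :
    U ∈ 𝓝 (u₀, vstar u₀) := H.isOpen_U.mem_nhds (H.graph_mem u₀ H.mem)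

theorem RelaxationHypotheses.contDiffAt_relaxA (H : RelaxationHypotheses F G q vstar U V u₀) :
    ContDiffAt ℝ 1 (relaxA F G) (u₀, vstar u₀) := by
  have h1 : ContDiffAt ℝ 1 (fderiv ℝ F) (u₀, vstar u₀) :=
    (H.contDiff_F.contDiffAt H.mem_U).fderiv_right (by norm_num)
  have h2 : ContDiffAt ℝ 1 (fderiv ℝ G) (u₀, vstar u₀) :=
    (H.contDiff_G.contDiffAt H.mem_U).fderiv_right (by norm_num)
  exact (ContinuousLinearMap.prodₗᵢ ℝ (𝕜 := ℝ) (E := RVec n × RVec m) (F := RVec n)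
    (G := RVec m)).contDiff.contDiffAt.comp _ (h1.prodMk h2)

theorem RelaxationHypotheses.continuousAt_relaxQ (H : RelaxationHypotheses F G q vstar U V u₀) :
    ContinuousAt (relaxQ q) (u₀, vstar u₀) := by
  have h1 : ContDiffAt ℝ 1 (fderiv ℝ q) (u₀, vstar u₀) :=
    (H.contDiff_q.contDiffAt H.mem_U).fderiv_right (by norm_num)
  have h2 : ContDiffAt ℝ 1 (relaxQ q) (u₀, vstar u₀) :=
    (ContinuousLinearMap.prodₗᵢ ℝ (𝕜 := ℝ) (E := RVec n × RVec m) (F := RVec n)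
      (G := RVec m)).contDiff.contDiffAt.comp _
      ((contDiffAt_const (c := (0 : RVec n × RVec m →L[ℝ] RVec n))).prodMk h1)
  exact h2.continuousAt

/-- The flux matrices are diagonalizable over the reals, with nonzero eigenvalues and a fixed
pattern of multiplicities. -/
theorem RelaxationHypotheses.exists_diagonalization
    (H : RelaxationHypotheses F G q vstar U V u₀) :
    ∃ (k : ℕ) (blk : Fin n ⊕ Fin m → Fin k), ∀ p ∈ U,
      ∃ (T : Matrix (Fin n ⊕ Fin m) (Fin n ⊕ Fin m) ℂ) (a : Fin k → ℝ), Function.Injective a ∧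
        (∀ j, a j ≠ 0) ∧ IsUnit T.det ∧ cMatrix (stdBasisProd n m) (relaxA F G p) * T =
          T * Matrix.diagonal fun i => ((a (blk i) : ℝ) : ℂ) := by
  obtain ⟨k, d, c, hc, -, hsum, hU⟩ := H.hyperbolic
  obtain ⟨blk, hblk⟩ := _root_.exists_diagonalization (stdBasisProd n m) hsum
  refine ⟨k, blk, fun p hp => ?_⟩
  obtain ⟨a, ha, haj⟩ := hU p hp
  obtain ⟨T, hT, hAT⟩ := hblk (relaxA F G p) a ha.injective fun j => (haj j).2
  exact ⟨T, a, ha.injective, fun j => abs_pos.mp (hc.trans_le (haj j).1), hT, hAT⟩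

theorem RelaxationHypotheses.isUnit_det_relaxA (H : RelaxationHypotheses F G q vstar U V u₀) :
    IsUnit (cMatrix (stdBasisProd n m) (relaxA F G (u₀, vstar u₀))).det := by
  obtain ⟨k, blk, h⟩ := H.exists_diagonalization
  obtain ⟨T, a, -, ha0, hT, hAT⟩ := h _ (H.graph_mem u₀ H.mem)
  have h1 := congrArg Matrix.det hAT
  rw [Matrix.det_mul, Matrix.det_mul, Matrix.det_diagonal, mul_comm] at h1
  rw [mul_left_cancel₀ hT.ne_zero h1, isUnit_iff_ne_zero, Finset.prod_ne_zero_iff]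
  exact fun i _ => by exact_mod_cast ha0 (blk i)

/-- Profiles that are uniformly close to the equilibrium state `(u₀, v*(u₀))` have uniformly small
derivatives, since these equal `A⁻¹(0, q)` and `q` vanishes at the equilibrium state. -/
theorem RelaxationHypotheses.eventually_state_mem (H : RelaxationHypotheses F G q vstar U V u₀)
    {ubar : ℝ → ℝ → RVec n} {vbar : ℝ → ℝ → RVec m} {um up : ℝ → RVec n} {vm vp : ℝ → RVec m}
    {l : Filter ℝ} (hprof : ∀ᶠ ε in l,
      IsRelaxationProfile F G q U (ubar ε) (vbar ε) (um ε) (up ε) (vm ε) (vp ε))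
    (hu : TendstoUniformly ubar (fun _ => u₀) l)
    (hv : TendstoUniformly vbar (fun _ => vstar u₀) l)
    {O : Set ((RVec n × RVec m) × (RVec n × RVec m))} (hO : O ∈ 𝓝 ((u₀, vstar u₀), 0)) :
    ∀ᶠ ε in l, ∀ x, ((ubar ε x, vbar ε x), (deriv (ubar ε) x, deriv (vbar ε) x)) ∈ O := by
  rw [nhds_prod_eq] at hO
  obtain ⟨O₁, hO₁, O₂, hO₂, hsub⟩ := mem_prod_iff.mp hO
  obtain ⟨η, hη, hball⟩ := Metric.nhds_basis_closedBall.mem_iff.mp hO₂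
  obtain ⟨b, hb, hbA⟩ := exists_pos_mul_norm_le (relaxA F G (u₀, vstar u₀))
    (injective_of_zero_notMem_spectrum (stdBasisProd n m) _ (by
      rw [spectrum.zero_notMem_iff, Matrix.isUnit_iff_isUnit_det]
      exact H.isUnit_det_relaxA))
  have hAc := Metric.tendsto_nhds.mp H.contDiffAt_relaxA.continuousAt (b / 2) (by positivity)
  have hq0 : q (u₀, vstar u₀) = 0 := H.equilibrium u₀ H.mem
  have hqc := Metric.tendsto_nhds.mp (H.contDiff_q.contDiffAt H.mem_U).continuousAt (b / 2 * η)
    (by positivity)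
  have hN : {p | p ∈ O₁ ∧ dist (relaxA F G p) (relaxA F G (u₀, vstar u₀)) < b / 2 ∧
      dist (q p) (q (u₀, vstar u₀)) < b / 2 * η} ∈ 𝓝 (u₀, vstar u₀) := by
    filter_upwards [hO₁, hAc, hqc] with p h1 h2 h3
    exact ⟨h1, h2, h3⟩
  rw [nhds_prod_eq] at hN
  obtain ⟨N₁, hN₁, N₂, hN₂, hNsub⟩ := mem_prod_iff.mp hN
  filter_upwards [hprof, hu.eventually_forall_mem hN₁, hv.eventually_forall_mem hN₂]
    with ε hp h1 h2 x
  obtain ⟨h3, h4, h5⟩ := hNsub (mk_mem_prod (h1 x) (h2 x))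
  refine hsub (mk_mem_prod h3 (hball (mem_closedBall_zero_iff.mpr ?_)))
  set p := (ubar ε x, vbar ε x)
  set p' := (deriv (ubar ε) x, deriv (vbar ε) x)
  have hder : HasDerivAt (fun y => (ubar ε y, vbar ε y)) p' x :=
    (hp.differentiable_u x).hasDerivAt.prodMk (hp.differentiable_v x).hasDerivAt
  have hUx : U ∈ 𝓝 p := H.isOpen_U.mem_nhds (hp.mem x)
  have hF : fderiv ℝ F p p' = 0 :=
    (((H.contDiff_F.contDiffAt hUx).differentiableAt two_ne_zero).hasFDerivAt.comp_hasDerivAt x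
      hder).unique (hp.equation_u x)
  have hG : fderiv ℝ G p p' = q p :=
    (((H.contDiff_G.contDiffAt hUx).differentiableAt two_ne_zero).hasFDerivAt.comp_hasDerivAt x
      hder).unique (hp.equation_v x)
  have hAp : relaxA F G p p' = (0, q p) := Prod.ext hF hG
  rw [hq0, dist_zero_right] at h5
  rw [dist_eq_norm] at h4
  have h6 : ‖relaxA F G (u₀, vstar u₀) p'‖ ≤ ‖q p‖ + b / 2 * ‖p'‖ := by
    have h7 : relaxA F G (u₀, vstar u₀) p' =
        relaxA F G p p' - (relaxA F G p - relaxA F G (u₀, vstar u₀)) p' := by simp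
    rw [h7]
    refine (norm_sub_le _ _).trans (add_le_add ?_ ?_)
    · rw [hAp, Prod.norm_mk, norm_zero, max_eq_right (norm_nonneg _)]
    · exact (ContinuousLinearMap.le_opNorm _ _).trans (by gcongr)
  have h8 := hbA p'
  nlinarith

/-- The nonzero spectrum of the source Jacobian `(0, Dq)` is contained in that of `q_v`, hence in the
open left half-plane. -/
theorem RelaxationHypotheses.relaxQ_mulVec_ne (H : RelaxationHypotheses F G q vstar U V u₀)
    {lam : ℂ} (hre : 0 ≤ lam.re) (hlam : lam ≠ 0) (w : Fin n ⊕ Fin m → ℂ) (hw : w ≠ 0) :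
    cMatrix (stdBasisProd n m) (relaxQ q (u₀, vstar u₀)) *ᵥ w ≠ lam • w := by
  intro heq
  have htop : ∀ i, w (Sum.inl i) = 0 := fun i => by
    have h1 := congrFun heq (Sum.inl i)
    have h2 : ∀ j, cMatrix (stdBasisProd n m) (relaxQ q (u₀, vstar u₀)) (Sum.inl i) j = 0 :=
      fun j => by rw [cMatrix_apply]; simp [stdBasisProd, relaxQ]
    simp only [Matrix.mulVec, dotProduct, h2, zero_mul, Finset.sum_const_zero, Pi.smul_apply,
      smul_eq_mul, zero_eq_mul] at h1
    exact h1.resolve_left hlam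
  have hq : DifferentiableAt ℝ q (u₀, vstar u₀) :=
    (H.contDiff_q.contDiffAt H.mem_U).differentiableAt two_ne_zero
  have hpart : fderiv ℝ (fun v => q (u₀, v)) (vstar u₀) =
      (fderiv ℝ q (u₀, vstar u₀)).comp (ContinuousLinearMap.inr ℝ (RVec n) (RVec m)) :=
    (hq.hasFDerivAt.comp (vstar u₀) (hasFDerivAt_prodMk_right u₀ (vstar u₀))).fderiv
  have hbot : cMatrix (stdBasis m) (fderiv ℝ (fun v => q (u₀, v)) (vstar u₀)) *ᵥ
      (fun i => w (Sum.inr i)) = lam • fun i => w (Sum.inr i) := by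
    funext i
    have h1 := congrFun heq (Sum.inr i)
    have h2 : ∀ j, cMatrix (stdBasisProd n m) (relaxQ q (u₀, vstar u₀)) (Sum.inr i) (Sum.inr j) =
        cMatrix (stdBasis m) (fderiv ℝ (fun v => q (u₀, v)) (vstar u₀)) i j := fun j => by
      have h3 : (stdBasis n).prod (stdBasis m) (Sum.inr j) =
          ContinuousLinearMap.inr ℝ (RVec n) (RVec m) (stdBasis m j) := Prod.ext
        (Module.Basis.prod_apply_inr_fst _ _ _) (Module.Basis.prod_apply_inr_snd _ _ _)
      rw [cMatrix_apply, cMatrix_apply, hpart, stdBasisProd, h3, Module.Basis.prod_repr_inr]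
      rfl
    simp only [Matrix.mulVec, dotProduct, Fintype.sum_sum_type, htop, mul_zero,
      Finset.sum_const_zero, zero_add, h2] at h1
    exact h1
  refine absurd (H.stable_source u₀ H.mem lam
    ((mem_spectrum_iff_exists_mulVec _ _).mpr ⟨_, fun h0 => hw ?_, hbot⟩)) (not_lt.mpr hre)
  funext i
  rcases i with i | i
  exacts [htop i, congrFun h0 i]

/-- The constant-coefficient eigenvalue problem at the equilibrium state has no oscillatory modes
for nonzero `λ` in the closed right half-plane. -/
theorem RelaxationHypotheses.pencil_hyperbolic (H : RelaxationHypotheses F G q vstar U V u₀)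
    {lam : ℂ} (hre : 0 ≤ lam.re) (hlam : lam ≠ 0) (ξ : ℝ) (w : Fin n ⊕ Fin m → ℂ) (hw : w ≠ 0) :
    (cMatrix (stdBasisProd n m) (relaxQ q (u₀, vstar u₀)) -
        lam • (1 : Matrix (Fin n ⊕ Fin m) (Fin n ⊕ Fin m) ℂ)) *ᵥ w ≠
      (Complex.I * ξ) • cMatrix (stdBasisProd n m) (relaxA F G (u₀, vstar u₀)) *ᵥ w := by
  intro heq
  rw [Matrix.sub_mulVec, Matrix.smul_mulVec, Matrix.one_mulVec, sub_eq_iff_eq_add] at heq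
  obtain ⟨θ, hθ, hst⟩ := H.stable
  rcases eq_or_ne ξ 0 with rfl | hξ
  · refine H.relaxQ_mulVec_ne hre hlam w hw ?_
    rw [heq]
    simp
  · have h1 : ((Complex.I * ((-ξ : ℝ) : ℂ)) •
        cMatrix (stdBasisProd n m) (relaxA F G (u₀, vstar u₀)) +
        cMatrix (stdBasisProd n m) (relaxQ q (u₀, vstar u₀))) *ᵥ w = lam • w := by
      rw [Matrix.add_mulVec, heq, Matrix.smul_mulVec]
      push_cast
      rw [mul_neg, neg_smul, neg_add_cancel_left]
    have h2 := hst (-ξ) lam ((mem_spectrum_iff_exists_mulVec _ _).mpr ⟨w, hw, h1⟩)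
    have h3 : -θ * (-ξ) ^ 2 / (1 + (-ξ) ^ 2) < 0 := by
      apply div_neg_of_neg_of_pos
      · have : 0 < (-ξ) ^ 2 := by rw [neg_sq]; positivity
        nlinarith
      · positivity
    linarith

/-- For profiles uniformly close to the equilibrium state, no unstable eigenvalue lies in a given
compact range `δ ≤ |λ| ≤ R` of frequencies. -/
theorem RelaxationHypotheses.eventually_norm_eigenvalue_notMem
    (H : RelaxationHypotheses F G q vstar U V u₀)
    {ubar : ℝ → ℝ → RVec n} {vbar : ℝ → ℝ → RVec m} {um up : ℝ → RVec n} {vm vp : ℝ → RVec m}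
    {l : Filter ℝ} (hprof : ∀ᶠ ε in l,
      IsRelaxationProfile F G q U (ubar ε) (vbar ε) (um ε) (up ε) (vm ε) (vp ε))
    (hu : TendstoUniformly ubar (fun _ => u₀) l)
    (hv : TendstoUniformly vbar (fun _ => vstar u₀) l) {δ : ℝ} (hδ : 0 < δ) (R : ℝ) :
    ∀ᶠ ε in l, ∀ lam : ℂ, 0 ≤ lam.re → IsRelaxationEigenvalue F G q (ubar ε) (vbar ε) lam →
      ‖lam‖ ∉ Icc δ R := by
  set M := Matrix (Fin n ⊕ Fin m) (Fin n ⊕ Fin m) ℂ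
  have hK : IsCompact {lam : ℂ | 0 ≤ lam.re ∧ ‖lam‖ ∈ Icc δ R} := by
    refine (isCompact_closedBall (0 : ℂ) R).of_isClosed_subset ?_ fun lam h => by
      simpa using h.2.2
    exact (isClosed_le continuous_const Complex.continuous_re).inter
      (isClosed_Icc.preimage continuous_norm)
  obtain ⟨O, hO, hsym⟩ := exists_uniform_pencil_symmetrizer hK
    ((cMatrix (stdBasisProd n m) (relaxA F G (u₀, vstar u₀)),
      cMatrix (stdBasisProd n m) (relaxQ q (u₀, vstar u₀))) : M × M)
    (fun p => p.2.1) (fun p => p.2.2 - p.1 • (1 : M)) (by fun_prop) (by fun_prop)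
    (fun k _ => H.isUnit_det_relaxA)
    (fun k hk => H.pencil_hyperbolic hk.1 (norm_pos_iff.mp (hδ.trans_le hk.2.1)))
  have hcoeff : ContinuousAt (fun p : RVec n × RVec m =>
      ((cMatrix (stdBasisProd n m) (relaxA F G p),
        cMatrix (stdBasisProd n m) (relaxQ q p)) : M × M))
      (u₀, vstar u₀) :=
    (((continuous_cMatrix _).tendsto _).comp H.contDiffAt_relaxA.continuousAt).prodMk_nhds
      (((continuous_cMatrix _).tendsto _).comp H.continuousAt_relaxQ)
  have hpre : {y : (RVec n × RVec m) × (RVec n × RVec m) |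
      (cMatrix (stdBasisProd n m) (relaxA F G y.1), cMatrix (stdBasisProd n m) (relaxQ q y.1)) ∈ O} ∈
      𝓝 ((u₀, vstar u₀), 0) :=
    (hcoeff.comp_of_eq (f := Prod.fst) continuousAt_fst rfl).eventually_mem hO
  have hev := H.eventually_state_mem hprof hu hv hpre
  filter_upwards [hev] with ε hε lam hre ⟨W, hW0, hW2, hode⟩ hmem
  obtain ⟨S, hS, c, hc, D, hSO⟩ := hsym lam ⟨hre, hmem⟩
  refine hW0 (eq_zero_of_pencil hS
    (N := fun x => cMatrix (stdBasisProd n m) (relaxA F G (ubar ε x, vbar ε x)))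
    (M := fun x => cMatrix (stdBasisProd n m) (relaxQ q (ubar ε x, vbar ε x)) - lam • (1 : M))
    (C := 0) (g := fun x => D ^ 2 * ‖W x‖ ^ 2) hc one_pos
    (fun x => (hSO _ (hε x) _).1) (fun x => (hSO _ (hε x) _).2)
    ((hW2.integrable_norm_pow two_ne_zero).const_mul _) (fun x => ?_) (fun x => ?_))
  · rw [zero_mul, add_zero, ← mul_pow]
    have := (hSO _ (hε x) (W x)).2
    gcongr
  · refine (hode x).congr_deriv ?_
    rw [Matrix.sub_mulVec, Matrix.smul_mulVec, Matrix.one_mulVec, Complex.ofReal_one, one_smul]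

/-- For profiles uniformly close to the equilibrium state, the unstable eigenvalues are bounded,
uniformly in `ε`. -/
theorem RelaxationHypotheses.exists_norm_eigenvalue_lt
    (H : RelaxationHypotheses F G q vstar U V u₀)
    {ubar : ℝ → ℝ → RVec n} {vbar : ℝ → ℝ → RVec m} {um up : ℝ → RVec n} {vm vp : ℝ → RVec m}
    {l : Filter ℝ} (hprof : ∀ᶠ ε in l,
      IsRelaxationProfile F G q U (ubar ε) (vbar ε) (um ε) (up ε) (vm ε) (vp ε))
    (hu : TendstoUniformly ubar (fun _ => u₀) l)
    (hv : TendstoUniformly vbar (fun _ => vstar u₀) l) :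
    ∃ R : ℝ, ∀ᶠ ε in l, ∀ lam : ℂ, 0 ≤ lam.re →
      IsRelaxationEigenvalue F G q (ubar ε) (vbar ε) lam → ‖lam‖ < R := by
  obtain ⟨k, blk, hdiag⟩ := H.exists_diagonalization
  obtain ⟨T, a, -, ha0, hT, hAT⟩ := hdiag _ (H.graph_mem u₀ H.mem)
  obtain ⟨θ, hθ, hst⟩ := H.stable
  set A : RVec n × RVec m → Matrix (Fin n ⊕ Fin m) (Fin n ⊕ Fin m) ℂ := fun p =>
    cMatrix (stdBasisProd n m) (relaxA F G p) with hA
  set Q : RVec n × RVec m → Matrix (Fin n ⊕ Fin m) (Fin n ⊕ Fin m) ℂ := fun p =>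
    cMatrix (stdBasisProd n m) (relaxQ q p) with hQ
  obtain ⟨S₀, K, hS₀, hK, hSA, hneg, hacc⟩ := exists_compensator (A (u₀, vstar u₀))
    (Q (u₀, vstar u₀)) T hT (fun i => a (blk i)) (fun i => ha0 _) hAT (half_pos hθ)
    (fun ξ hξ μ hμ => by
      -- `θ ξ² / (1 + ξ²) ≥ θ / 2` for `ξ ≥ 1`
      refine (hst ξ μ hμ).trans ?_
      rw [div_le_iff₀ (by positivity)]
      have : 1 ≤ ξ ^ 2 := by nlinarith
      nlinarith)
  obtain ⟨S, hSd, hS0, hSH, hsym⟩ := exists_contDiffAt_symmetrizer (A := A)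
    (fun i j => contDiffAt_cMatrix (stdBasisProd n m) H.contDiffAt_relaxA i j) blk (by
      filter_upwards [H.mem_U] with p hp
      obtain ⟨T, a, ha, -, hT, hAT⟩ := hdiag p hp
      exact ⟨T, a, ha, hT, hAT⟩) hS₀ hSA
  have hAc : ContinuousAt A (u₀, vstar u₀) :=
    ((continuous_cMatrix _).tendsto _).comp H.contDiffAt_relaxA.continuousAt
  have hQc : ContinuousAt Q (u₀, vstar u₀) :=
    ((continuous_cMatrix _).tendsto _).comp H.continuousAt_relaxQ
  obtain ⟨R, -, c, hc, D, hen⟩ := exists_highFrequency_energy (K := K) hAc hQc hSd hSH hsym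
    (by rw [hS0]; exact hneg) (by rw [hS0]; exact hacc)
  refine ⟨R, ?_⟩
  filter_upwards [hprof, H.eventually_state_mem hprof hu hv hen] with ε hp hε lam hre
    ⟨W, hW0, hW2, hode⟩
  by_contra! hlam
  set β : ℂ := ((lam.im / ‖lam‖ ^ 2 : ℝ) : ℂ)
  set p : ℝ → RVec n × RVec m := fun x => (ubar ε x, vbar ε x)
  set p' : ℝ → RVec n × RVec m := fun x => (deriv (ubar ε) x, deriv (vbar ε) x)
  have hp' : ∀ x, HasDerivAt p (p' x) x := fun x =>
    (hp.differentiable_u x).hasDerivAt.prodMk (hp.differentiable_v x).hasDerivAt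
  have hSp : ∀ x i j, HasDerivAt (fun y => (S (p y) + β • K) i j)
      (fderiv ℝ (fun p => S p i j) (p x) (p' x)) x := fun x i j =>
    (((hε x).1 i j).hasFDerivAt.comp_hasDerivAt x (hp' x)).add_const _
  have hherm : ∀ x, (S (p x) + β • K).IsHermitian := fun x => by
    rw [Matrix.IsHermitian, Matrix.conjTranspose_add, Matrix.conjTranspose_smul, (hSH _).eq, hK.eq,
      Complex.star_def, Complex.conj_ofReal]
  refine hW0 (eq_zero_of_energy (C := 0) (D := D) (g := fun x => D * ‖W x‖ ^ 2) hc
    (fun x => hasDerivAt_dotProduct_mulVec (S := fun y => S (p y) + β • K)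
      (S' := Matrix.of fun i j => fderiv ℝ (fun p => S p i j) (p x) (p' x))
      (hSp x) (hode x) (hherm x))
    (fun x => ((hε x).2 lam hre hlam (W x)).1) (fun x => ((hε x).2 lam hre hlam (W x)).2)
    ((hW2.integrable_norm_pow two_ne_zero).const_mul _) (fun x => ?_))
  rw [zero_mul, add_zero]
  exact ((hε x).2 lam hre hlam (W x)).2

/-- For profiles uniformly close to the equilibrium state, no unstable eigenvalue has modulus above
`δ`. -/
theorem RelaxationHypotheses.eventually_norm_eigenvalue_le
    (H : RelaxationHypotheses F G q vstar U V u₀)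
    {ubar : ℝ → ℝ → RVec n} {vbar : ℝ → ℝ → RVec m} {um up : ℝ → RVec n} {vm vp : ℝ → RVec m}
    {l : Filter ℝ} (hprof : ∀ᶠ ε in l,
      IsRelaxationProfile F G q U (ubar ε) (vbar ε) (um ε) (up ε) (vm ε) (vp ε))
    (hu : TendstoUniformly ubar (fun _ => u₀) l)
    (hv : TendstoUniformly vbar (fun _ => vstar u₀) l) {δ : ℝ} (hδ : 0 < δ) :
    ∀ᶠ ε in l, ∀ lam : ℂ, 0 ≤ lam.re → IsRelaxationEigenvalue F G q (ubar ε) (vbar ε) lam →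
      ‖lam‖ ≤ δ := by
  obtain ⟨R, hR⟩ := H.exists_norm_eigenvalue_lt hprof hu hv
  filter_upwards [hR, H.eventually_norm_eigenvalue_notMem hprof hu hv hδ R] with ε h1 h2 lam hre hev
  by_contra! hlt
  exact h2 lam hre hev ⟨hlt.le, (h1 lam hre hev).le⟩

end Relaxation

/-! ### Small unstable eigenvalues of weak shock profiles -/

theorem proposition2p9 :
    -- viscous systems
    (∀ (n : ℕ) (f : RVec n → RVec n) (B : RVec n → RVec n →L[ℝ] RVec n)
        (U : Set (RVec n)) (u₀ : RVec n), ViscousHypotheses f B U u₀ →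
      ∀ (ε₀ : ℝ), 0 < ε₀ →
      ∀ (ubar : ℝ → ℝ → RVec n) (um up : ℝ → RVec n),
        (∀ ε ∈ Ioo 0 ε₀, IsViscousProfile f B U (ubar ε) (um ε) (up ε) ∧ ‖up ε - um ε‖ = ε) →
        TendstoUniformly ubar (fun _ => u₀) (𝓝[>] (0 : ℝ)) →
        ∃ ε₁ ∈ Ioc 0 ε₀, ∃ r : ℝ → ℝ, Tendsto r (𝓝[>] (0 : ℝ)) (𝓝 0) ∧
          ∀ ε ∈ Ioo 0 ε₁, ∀ lam : ℂ, 0 ≤ lam.re →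
            IsViscousEigenvalue f B (ubar ε) lam → ‖lam‖ ≤ r ε) ∧
    -- relaxation systems
    (∀ (n m : ℕ) (F : RVec n × RVec m → RVec n) (G q : RVec n × RVec m → RVec m)
        (vstar : RVec n → RVec m) (U : Set (RVec n × RVec m)) (V : Set (RVec n)) (u₀ : RVec n),
        RelaxationHypotheses F G q vstar U V u₀ →
      ∀ (ε₀ : ℝ), 0 < ε₀ →
      ∀ (ubar : ℝ → ℝ → RVec n) (vbar : ℝ → ℝ → RVec m)
        (um up : ℝ → RVec n) (vm vp : ℝ → RVec m),
        (∀ ε ∈ Ioo 0 ε₀,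
          IsRelaxationProfile F G q U (ubar ε) (vbar ε) (um ε) (up ε) (vm ε) (vp ε) ∧
          ‖up ε - um ε‖ = ε ∧ um ε ∈ V ∧ up ε ∈ V ∧
          RealSimpleSpectrum (fderiv ℝ (equilibriumFlux F vstar) (um ε)) ∧
          RealSimpleSpectrum (fderiv ℝ (equilibriumFlux F vstar) (up ε))) →
        TendstoUniformly ubar (fun _ => u₀) (𝓝[>] (0 : ℝ)) →
        TendstoUniformly vbar (fun _ => vstar u₀) (𝓝[>] (0 : ℝ)) →
        ∃ ε₁ ∈ Ioc 0 ε₀, ∃ r : ℝ → ℝ, Tendsto r (𝓝[>] (0 : ℝ)) (𝓝 0) ∧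
          ∀ ε ∈ Ioo 0 ε₁, ∀ lam : ℂ, 0 ≤ lam.re →
            IsRelaxationEigenvalue F G q (ubar ε) (vbar ε) lam → ‖lam‖ ≤ r ε) := by
  refine ⟨fun n f B U u₀ H ε₀ hε₀ ubar um up h hunif => ?_,
    fun n m F G q vstar U V u₀ H ε₀ hε₀ ubar vbar um up vm vp h hu hv => ?_⟩
  · refine exists_modulus (P := fun ε lam => IsViscousEigenvalue f B (ubar ε) lam) hε₀
      fun δ hδ => H.eventually_norm_eigenvalue_le (um := um) (up := up) ?_ hunif hδ
    filter_upwards [Ioo_mem_nhdsGT hε₀] with ε hε using (h ε hε).1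
  · refine exists_modulus (P := fun ε lam => IsRelaxationEigenvalue F G q (ubar ε) (vbar ε) lam)
      hε₀ fun δ hδ => H.eventually_norm_eigenvalue_le (um := um) (up := up) (vm := vm) (vp := vp)
        ?_ hu hv hδ
    filter_upwards [Ioo_mem_nhdsGT hε₀] with ε hε using (h ε hε).1
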